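/- **Proposition 3.1.** Let $(\mathcal A,\mathcal H,D)$ be a spectral triple: $\mathcal A$ is a unital complex $*$-algebra, $\pi$ is a faithful unital $*$-representation of $\mathcal A$ by bounded operators on the separable Hilbert space $\mathcal H$, and $D$ is a self-adjoint operator on $\mathcal H$ with compact resolvent such that $da:=[D,\pi(a)]$ is bounded for every $a\in\mathcal A$ (with $\pi(a)$ preserving the domain of $D$). Let $|D|^{-1}$ denote the inverse of $|D|=\sqrt{D^2}$ on $(\ker D)^\perp$, extended by $0$ to $\ker D$. Assume: * (dimension 3) the decreasing sequence $(\lambda_k)$ of eigenvalues of $|D|^{-1}$, counted with multiplicity, satisfies $\lambda_k=O(k^{-1/3})$; * (regularity) every element of the algebra generated by $\pi(\mathcal A)$ and $[D,\pi(\mathcal A)]$ lies in the domain of all powers of the derivation $\delta(b)=[|D|,b]$; * (closedness) $\mathrm{Tr}_\omega\big([D,\pi(a_1)][D,\pi(a_2)][D,\pi(a_3)]\,|D|^{-3}\big)=0$ for all $a_1,a_2,a_3\in\mathcal A$. Here $\mathrm{Tr}_\omega$ is the Dixmier trace attached to a fixed generalized limit $\omega$, i.e. a positive linear form on the bounded real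 sequences that extends the ordinary limit and satisfies $\omega(\alpha_0,\alpha_0,\alpha_1,\alpha_1,\dots)=\omega(\alpha_0,\alpha_1,\dots)$; on positive operators $T$ with singular numbers $\mu_k(T)$ it is given by $\mathrm{Tr}_\omega(T)=\omega\big(\tfrac1{\log N}\sum_{k<N}\mu_k(T)\big)$, and it is extended by linearity. Put $$\int\!\!\!\!\!\!-\; b\,ds^3=\frac{\pi^{3/2}\,\Gamma(5/2)}{2^{-2}}\;\mathrm{Tr}_\omega\big(b|D|^{-3}\big)$$ (in this constant $\pi$ is the number and $\Gamma$ is Euler's function) and, for $N\in\mathbb N$, matrices $a_0,\dots,a_3\in M_N(\mathcal A)$ and a unitary $u\in U_N(\mathcal A)\subset M_N(\mathcal A)$, with $d$ acting entrywise and $\mathrm{tr}$ the matrix trace, $$\tilde\Phi(a_0,a_1,a_2,a_3)=\int\!\!\!\!\!\!-\;\mathrm{tr}\big(a_0\,da_1\,da_2\,da_3\big)\,ds^3,\qquad \Gamma[u]=-\frac13\int\!\!\!\!\!\!-\;\mathrm{tr}\big(u\,du^{-1}\,u\,du^{-1}\,u\,du^{-1}\big)\,ds^3 .$$ Then: 1.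 For every $N$, $\tilde\Phi$ is a cyclic 3-cocycle on $M_N(\mathcal A)$: it is 4-linear, satisfies $\tilde\Phi(a_0,a_1,a_2,a_3)=-\tilde\Phi(a_1,a_2,a_3,a_0)$, and $$\tilde\Phi(a_0a_1,a_2,a_3,a_4)-\tilde\Phi(a_0,a_1a_2,a_3,a_4)+\tilde\Phi(a_0,a_1,a_2a_3,a_4)-\tilde\Phi(a_0,a_1,a_2,a_3a_4)+\tilde\Phi(a_4a_0,a_1,a_2,a_3)=0 .$$ 2. For every $N$ and every unitary $u\in U_N(\mathcal A)$, $$\Gamma[u]=\tfrac13\,\tilde\Phi\big(u-1,\,u^{-1}-1,\,u-1,\,u^{-1}-1\big).$$ 3. $\Gamma[u]$ depends only on the class of $u$ in $K_1$. For a topological $*$-algebra $R$ let $U_\infty(R)=\bigcup_N U_N(R)$, the union being taken along $u\mapsto\begin{pmatrix}u&0\\0&1\end{pmatrix}$, with the inductive limit topology, and let $K_1(R)=\pi_0(U_\infty(R))$ be its set of connected components. If $u\in U_M(\mathcal A)$ and $v\in U_N(\mathcal A)$ have the same class in $K_1(\mathcal A)$, where $\mathcal A$ carries the norm $\|a\|=\|\pi(a)\|$,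 then $\Gamma[u]=\Gamma[v]$; that is, $\Gamma$ is constant on the connected components of $U_\infty(\mathcal A)$. The same conclusion holds if $u$ and $v$ have the same class in $K_1(\overline{\mathcal A})$, where $\overline{\mathcal A}$ is the $C^*$-algebra obtained as the operator norm closure of $\pi(\mathcal A)$. -/

import Mathlib

open scoped BoundedContinuousFunction

noncomputable section

/-! ### Topological `K_1` -/

section KTheory

variable (R : Type*) [Ring R] [StarRing R]

/-- `U_N(R)`, the group of unitary elements of `M_N(R)`. -/
abbrev UN (N : ℕ) : Type _ := unitary (Matrix (Fin N) (Fin N) R)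

variable {R} in
/-- The infinite matrix `diag(a, 1, 1, …)`. Two finite matrices have the same image precisely when
they become equal under the embeddings `a ↦ diag(a, 1)`. -/
def padMatrix {N : ℕ} (a : Matrix (Fin N) (Fin N) R) : Matrix ℕ ℕ R :=
  Matrix.of fun i j =>
    if h : i < N ∧ j < N then a ⟨i, h.1⟩ ⟨j, h.2⟩ else if i = j then 1 else 0

/-- `U_∞(R) = ⋃_N U_N(R)`, the union being taken along `u ↦ diag(u, 1)`. -/
def UInf : Type _ :=
  {g : Matrix ℕ ℕ R // ∃ (N : ℕ) (u : UN R N), padMatrix (u : Matrix (Fin N) (Fin N) R) = g}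

variable {R} in
/-- The inclusion of `U_N(R)` into `U_∞(R)`. -/
def UInf.incl {N : ℕ} (u : UN R N) : UInf R :=
  ⟨padMatrix (u : Matrix (Fin N) (Fin N) R), N, u, rfl⟩

/-- The inductive limit topology on `U_∞(R)`; each `U_N(R)` carries the topology of entrywise
convergence, which is the norm topology of `M_N(R)` when `R` is normed. -/
instance UInf.instTopologicalSpace [TopologicalSpace R] : TopologicalSpace (UInf R) :=
  ⨆ N : ℕ, TopologicalSpace.coinduced (fun u : UN R N => UInf.incl u) inferInstance

/-- `K_1(R) = π_0(U_∞(R))`, the (underlying set of the group of) connected components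
of `U_∞(R)`. -/
def K1 [TopologicalSpace R] : Type _ := ConnectedComponents (UInf R)

variable {R} in
/-- The class in `K_1(R)` of a unitary matrix over `R`. -/
def K1.mk [TopologicalSpace R] {N : ℕ} (u : UN R N) : K1 R :=
  ConnectedComponents.mk (UInf.incl u)

end KTheory

/-- The entrywise action of a star homomorphism on unitary matrices. -/
def UN.map {R S : Type*} [Ring R] [StarRing R] [Algebra ℂ R] [Ring S] [StarRing S] [Algebra ℂ S]
    (f : R →⋆ₐ[ℂ] S) {N : ℕ} (u : UN R N) : UN S N :=
  ⟨(u : Matrix (Fin N) (Fin N) R).map f, by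
    have key : ∀ a b : Matrix (Fin N) (Fin N) R, (a * b).map f = a.map f * b.map f :=
      fun a b => Matrix.map_mul
    have hs : ∀ a : Matrix (Fin N) (Fin N) R, star (a.map f) = (star a).map f := by
      intro a
      ext i j
      exact (map_star f (a j i)).symm
    have h1 : (1 : Matrix (Fin N) (Fin N) R).map f = 1 := Matrix.map_one f (map_zero f) (map_one f)
    rw [Unitary.mem_iff, hs, ← key, ← key, Unitary.star_mul_self_of_mem u.2,
      Unitary.mul_star_self_of_mem u.2]
    exact ⟨h1, h1⟩⟩

/-! ### Singular numbers and the Dixmier trace -/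

section Operators

variable {H : Type*} [NormedAddCommGroup H] [InnerProductSpace ℂ H]

/-- The `k`-th singular number of a bounded operator (`k = 0, 1, 2, …`): its distance to the
operators of rank at most `k`. For a compact positive operator these are the eigenvalues,
repeated according to multiplicity, in decreasing order. -/
def singularNumber (T : H →L[ℂ] H) (k : ℕ) : ℝ :=
  sInf {r : ℝ | ∃ F : H →L[ℂ] H, LinearMap.rank (F : H →ₗ[ℂ] H) ≤ (k : Cardinal) ∧ r = ‖T - F‖}

/-- A generalized limit of the kind used to define Dixmier traces: a positive linear form on the
bounded real sequences which extends the ordinary limit and is invariant under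
`(α_0, α_1, …) ↦ (α_0, α_0, α_1, α_1, …)`. -/
structure DixmierLimit where
  toLinearMap : (ℕ →ᵇ ℝ) →ₗ[ℝ] ℝ
  nonneg : ∀ s : ℕ →ᵇ ℝ, (∀ n, 0 ≤ s n) → 0 ≤ toLinearMap s
  eq_of_tendsto : ∀ (s : ℕ →ᵇ ℝ) (l : ℝ),
    Filter.Tendsto (fun n => s n) Filter.atTop (nhds l) → toLinearMap s = l
  scale_invariant : ∀ s : ℕ →ᵇ ℝ,
    toLinearMap (s.compContinuous ⟨fun n : ℕ => n / 2, continuous_of_discreteTopology⟩) =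
      toLinearMap s

open Classical in
/-- The value of a generalized limit on a sequence (`0` if the sequence is unbounded). -/
def DixmierLimit.lim (ω : DixmierLimit) (s : ℕ → ℝ) : ℝ :=
  if h : ∃ C : ℝ, ∀ n, ‖s n‖ ≤ C then
    ω.toLinearMap (BoundedContinuousFunction.ofNormedAddCommGroupDiscrete s h.choose h.choose_spec)
  else 0

/-- `lim_ω (1 / log N) ∑_{k < N} μ_k(T)`, the Dixmier trace on positive operators. -/
def dixmierTracePos (ω : DixmierLimit) (T : H →L[ℂ] H) : ℝ :=
  ω.lim fun N => (∑ k ∈ Finset.range N, singularNumber T k) / Real.log N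

/-- The Dixmier trace `Tr_ω`, extended by linearity from positive operators through
`T = (ℜ T)⁺ - (ℜ T)⁻ + i ((ℑ T)⁺ - (ℑ T)⁻)`. It is meant for operators `T` in the ideal
`L^{(1,∞)}`, i.e. with `∑_{k < N} μ_k(T) = O(log N)`. -/
def dixmierTrace [CompleteSpace H] (ω : DixmierLimit) (T : H →L[ℂ] H) : ℂ :=
  ((dixmierTracePos ω ((realPart T : H →L[ℂ] H)⁺)
      - dixmierTracePos ω ((realPart T : H →L[ℂ] H)⁻) : ℝ) : ℂ)
    + Complex.I * ((dixmierTracePos ω ((imaginaryPart T : H →L[ℂ] H)⁺)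
      - dixmierTracePos ω ((imaginaryPart T : H →L[ℂ] H)⁻) : ℝ) : ℂ)

/-! ### Unbounded operators -/

/-- `b` preserves the domain of `D`, and `[D, b]` is (on that domain) the bounded operator `c`. -/
def HasCommutator (D : H →ₗ.[ℂ] H) (b c : H →L[ℂ] H) : Prop :=
  ∀ x : D.domain, ∃ h : b (x : H) ∈ D.domain, D ⟨b (x : H), h⟩ - b (D x) = c (x : H)

/-- `D` has compact resolvent: `(D + i)⁻¹` is everywhere defined and compact. -/
def HasCompactResolvent (D : H →ₗ.[ℂ] H) : Prop :=
  ∃ R : H →L[ℂ] H, IsCompactOperator R ∧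
    (∀ y : H, ∃ h : R y ∈ D.domain, D ⟨R y, h⟩ + Complex.I • R y = y) ∧
    ∀ x : D.domain, R (D x + Complex.I • (x : H)) = x

/-- The eigenspace of `D` for the real number `l` (zero unless `l` is an eigenvalue). -/
def eigenspace (D : H →ₗ.[ℂ] H) (l : ℝ) : Submodule ℂ H where
  carrier := {x | ∃ h : x ∈ D.domain, D ⟨x, h⟩ = (l : ℂ) • x}
  zero_mem' := ⟨D.domain.zero_mem, by
    have : (⟨0, D.domain.zero_mem⟩ : D.domain) = 0 := rfl
    rw [this, LinearPMap.map_zero, smul_zero]⟩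
  add_mem' := by
    rintro x y ⟨hx, ex⟩ ⟨hy, ey⟩
    refine ⟨D.domain.add_mem hx hy, ?_⟩
    have : (⟨x + y, D.domain.add_mem hx hy⟩ : D.domain) = ⟨x, hx⟩ + ⟨y, hy⟩ := rfl
    rw [this, LinearPMap.map_add, ex, ey, smul_add]
  smul_mem' := by
    rintro c x ⟨hx, ex⟩
    refine ⟨D.domain.smul_mem c hx, ?_⟩
    have : (⟨c • x, D.domain.smul_mem c hx⟩ : D.domain) = c • ⟨x, hx⟩ := rfl
    rw [this, LinearPMap.map_smul, ex, smul_comm]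

variable [CompleteSpace H]

/-- The orthogonal projection onto the (automatically closed, if `D` is closed) eigenspace. -/
def eigenProj (D : H →ₗ.[ℂ] H) (l : ℝ) : H →L[ℂ] H :=
  (eigenspace D l).topologicalClosure.starProjection

/-- `|D|` for a self-adjoint operator `D` with compact resolvent. Such an operator is
diagonalizable, `D = ∑ l P_l` with `P_l` the spectral projections, and
`|D| = √(D²) = ∑ |l| P_l`, on the domain of all vectors for which the sum converges. -/
def absOp (D : H →ₗ.[ℂ] H) : H →ₗ.[ℂ] H where
  domain :=
    { carrier := {x | Summable fun l : ℝ => ((|l| : ℝ) : ℂ) • eigenProj D l x}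
      zero_mem' := by simp [summable_zero]
      add_mem' := fun {x y} hx hy => by simpa using Summable.add hx hy
      smul_mem' := fun c x hx => by
        have h : Summable fun l : ℝ => c • (((|l| : ℝ) : ℂ) • eigenProj D l x) :=
          Summable.const_smul c hx
        simpa [smul_comm c] using h }
  toFun :=
    { toFun := fun x => ∑' l : ℝ, ((|l| : ℝ) : ℂ) • eigenProj D l (x : H)
      map_add' := fun x y => by
        rw [← Summable.tsum_add x.2 y.2]
        simp
      map_smul' := fun c x => by
        have h := Summable.tsum_const_smul c x.2
        simp only [RingHom.id_apply]
        rw [← h]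
        simp [smul_comm c] }

/-- The bounded operator `|D|⁻¹ = ∑_{l ≠ 0} |l|⁻¹ P_l` (a norm convergent sum if `D` is
self-adjoint with compact resolvent): the inverse of `|D|` on the orthogonal complement of
`ker D`, extended by `0` to `ker D`. -/
def absInv (D : H →ₗ.[ℂ] H) : H →L[ℂ] H :=
  ∑' l : ℝ, ((|l|⁻¹ : ℝ) : ℂ) • eigenProj D l

/-- `b` lies in the domain of `δ^k`, where `δ(b) = [|D|, b]`. -/
def InDomDeltaPow (D : H →ₗ.[ℂ] H) : ℕ → (H →L[ℂ] H) → Prop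
  | 0, _ => True
  | k + 1, b => ∃ c : H →L[ℂ] H, HasCommutator (absOp D) b c ∧ InDomDeltaPow D k c

end Operators

/-! ### Spectral triples -/

/-- A spectral triple `(A, H, D)`. -/
structure SpectralTriple (A : Type*) [Ring A] [StarRing A] [Algebra ℂ A]
    (H : Type*) [NormedAddCommGroup H] [InnerProductSpace ℂ H] [CompleteSpace H] where
  π : A →⋆ₐ[ℂ] (H →L[ℂ] H)
  faithful : Function.Injective π
  D : H →ₗ.[ℂ] H
  selfAdjoint : IsSelfAdjoint D
  compactResolvent : HasCompactResolvent D
  boundedCommutator : ∀ a : A, ∃ c : H →L[ℂ] H, HasCommutator D (π a) c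

namespace SpectralTriple

variable {A : Type*} [Ring A] [StarRing A] [Algebra ℂ A]
  {H : Type*} [NormedAddCommGroup H] [InnerProductSpace ℂ H] [CompleteSpace H]
  (T : SpectralTriple A H)

/-- `da = [D, π(a)]` as a bounded operator. -/
def d (a : A) : H →L[ℂ] H := Classical.choose (T.boundedCommutator a)

/-- The triple has dimension `n`: the decreasing sequence of eigenvalues of `|D|⁻¹`
is `O(k^{-1/n})`. -/
def HasDimension (n : ℕ) : Prop :=
  0 < n ∧ (fun k : ℕ => singularNumber (absInv T.D) k) =O[Filter.atTop]
    fun k : ℕ => (k : ℝ) ^ (-(1 / (n : ℝ)))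

/-- The algebra `B` generated by `π(A)` and `[D, π(A)]`. -/
def algB : Subalgebra ℂ (H →L[ℂ] H) :=
  Algebra.adjoin ℂ (Set.range T.π ∪ Set.range T.d)

/-- The regularity axiom. -/
def Regular : Prop := ∀ b ∈ T.algB, ∀ k : ℕ, InDomDeltaPow T.D k b

/-- The closedness condition in dimension three. -/
def Closed (ω : DixmierLimit) : Prop :=
  ∀ a b c : A, dixmierTrace ω (T.d a * T.d b * T.d c * absInv T.D ^ 3) = 0

/-- The noncommutative integral in dimension `n = 3`,
`∫ b ds³ = (π^{n/2} Γ(n/2 + 1) / 2^{[n/2] - n}) Tr_ω(b |D|⁻³)`. -/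
def integral (ω : DixmierLimit) (b : H →L[ℂ] H) : ℂ :=
  ((Real.pi ^ (3 / 2 : ℝ) * Real.Gamma (3 / 2 + 1) / (2 : ℝ) ^ ((1 : ℤ) - 3) : ℝ) : ℂ) *
    dixmierTrace ω (b * absInv T.D ^ 3)

/-- `Φ̃(a₀, a₁, a₂, a₃) = ∫ tr(a₀ da₁ da₂ da₃) ds³` for matrices `a_i ∈ M_N(A)`. -/
def PhiTilde (ω : DixmierLimit) {N : ℕ} (a₀ a₁ a₂ a₃ : Matrix (Fin N) (Fin N) A) : ℂ :=
  T.integral ω (Matrix.trace (a₀.map T.π * a₁.map T.d * a₂.map T.d * a₃.map T.d))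

/-- `Γ[u] = -(1/3) ∫ tr(u du⁻¹ u du⁻¹ u du⁻¹) ds³` for a unitary `u ∈ M_N(A)`; note
`u⁻¹ = star u`. -/
def Gamma (ω : DixmierLimit) {N : ℕ} (u : UN A N) : ℂ :=
  -(1 / 3 : ℂ) * T.integral ω (Matrix.trace
    (((u : Matrix (Fin N) (Fin N) A).map T.π *
      (star (u : Matrix (Fin N) (Fin N) A)).map T.d) ^ 3))

/-- The class of `u` in `K_1(A)`, where `A` is identified with `π(A)` and carries the operator
norm topology. -/
def k1Class {N : ℕ} (u : UN A N) : K1 T.π.range := K1.mk (UN.map T.π.rangeRestrict u)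

/-- The class of `u` in `K_1` of the `C*`-algebra obtained as the norm closure of `π(A)`. -/
def k1ClassClosure {N : ℕ} (u : UN A N) : K1 T.π.range.topologicalClosure :=
  K1.mk (UN.map ((StarSubalgebra.inclusion T.π.range.le_topologicalClosure).comp
    T.π.rangeRestrict) u)

end SpectralTriple

/-- A cyclic 3-cocycle on a complex algebra `R`: a 4-linear form which is a Hochschild cocycle and
satisfies `φ(a₀, a₁, a₂, a₃) = -φ(a₁, a₂, a₃, a₀)`. -/
structure IsCyclicThreeCocycle {R : Type*} [Ring R] [Algebra ℂ R] (φ : R → R → R → R → ℂ) :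
    Prop where
  multilinear : ∃ m : MultilinearMap ℂ (fun _ : Fin 4 => R) ℂ,
    ∀ a₀ a₁ a₂ a₃, m ![a₀, a₁, a₂, a₃] = φ a₀ a₁ a₂ a₃
  hochschild : ∀ a₀ a₁ a₂ a₃ a₄,
    φ (a₀ * a₁) a₂ a₃ a₄ - φ a₀ (a₁ * a₂) a₃ a₄ + φ a₀ a₁ (a₂ * a₃) a₄
      - φ a₀ a₁ a₂ (a₃ * a₄) + φ (a₄ * a₀) a₁ a₂ a₃ = 0
  cyclic : ∀ a₀ a₁ a₂ a₃, φ a₀ a₁ a₂ a₃ = -φ a₁ a₂ a₃ a₀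

end

/-!
All three assertions are formal consequences of properties of the linear form
`τ(b) = Tr_ω(b |D|⁻³)`, which are established first.

*Analysis.* The operator `|D|⁻¹` has singular numbers `O(k^{-1/3})`, so `|D|⁻³` lies in the weak
trace ideal, where the Dixmier trace is additive and bounded (by the Ky Fan inequalities
`σ_N(S + T) ≤ σ_N(S) + σ_N(T) ≤ σ_{2N}(S + T)` for sums of singular numbers of positive operators
and the invariance of the generalized limit under doubling), tracial (by unitary invariance,
as every bounded operator is a combination of unitaries), and zero on operators with singular numbers
`O(k^{-p})`, `p > 1`. If
`[|D|, b]` is bounded, then, up to finite rank, `[b, |D|⁻¹] = |D|⁻¹ [|D|, b] |D|⁻¹` gains one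
order, so `[b, |D|⁻³]` has singular numbers `O(k^{-4/3})`
(`commutator_absInv_cube_mem_weakSchatten`). Hence `τ(b) = Tr_ω(b |D|⁻³)` is a bounded linear form
with `τ(x b) = τ(b x)` whenever `b` is some `π(a)` or `da`. This is packaged as a `ThreeCycle`;
only this structure is used from then on, also for matrices over the algebra
(`ThreeCycle.matrix`).

*Algebra.* The Leibniz rule and the trace property give the Hochschild identity, and the
closedness condition applied to `d(a₀a₁) da₂ da₃` gives cyclicity. For `v = u⁻¹` one has
`u (dv) u = -du`, which turns `τ((u dv)³)` into the character evaluated at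
`u - 1, v - 1, u - 1, v - 1`.

*Homotopy invariance.* Up to a constant `Γ[u]` is `τ((u⁻¹ du)³)`. The expression `τ((g⁻¹ dg)³)`
makes sense for every `g` with `π(g)` invertible in the bounded operators, and its derivative in a
direction `k` is a multiple of `τ(dg d(g⁻¹) d(k g⁻¹))`. Here `g⁻¹` need not belong to the algebra,
but if `π(g)` has an approximate inverse in `π(A)`, Neumann series approximate `g⁻¹` by elements
of the algebra in such a way that their differentials converge too
(`ThreeCycle.exists_tendsto_inverse`), so closedness still makes the derivative vanish. Segments
between elements close to a fixed unitary `W` over the norm closure stay invertible, so the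
invariant takes a single value on all `g` near `W` (`ThreeCycle.exists_eventually_invariant_eq`).
This defines a locally constant function of `W`, compatible with `W ↦ diag(W, 1)`, hence a locally
constant function on `U_∞` of the closure, which is constant on connected components. The map
`U_∞(A) → U_∞(Ā)` is continuous, which settles the case of `A` itself.
-/

/-! ### Singular numbers -/

section SingularNumbers

variable {H : Type*} [NormedAddCommGroup H] [InnerProductSpace ℂ H]

theorem singularNumber_nonneg (T : H →L[ℂ] H) (k : ℕ) : 0 ≤ singularNumber T k :=
  Real.sInf_nonneg (by rintro _ ⟨F, -, rfl⟩; exact norm_nonneg _)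

theorem singularNumber_le (T : H →L[ℂ] H) {k : ℕ} {F : H →L[ℂ] H}
    (hF : LinearMap.rank (F : H →ₗ[ℂ] H) ≤ (k : Cardinal)) : singularNumber T k ≤ ‖T - F‖ :=
  csInf_le ⟨0, by rintro _ ⟨F, -, rfl⟩; exact norm_nonneg _⟩ ⟨F, hF, rfl⟩

theorem rank_clm_zero_le (k : ℕ) :
    LinearMap.rank ((0 : H →L[ℂ] H) : H →ₗ[ℂ] H) ≤ (k : Cardinal) := by
  have h : LinearMap.range ((0 : H →L[ℂ] H) : H →ₗ[ℂ] H) = ⊥ := LinearMap.range_zero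
  rw [LinearMap.rank, h, rank_bot]
  exact zero_le

theorem le_singularNumber (T : H →L[ℂ] H) {k : ℕ} {c : ℝ}
    (h : ∀ F : H →L[ℂ] H, LinearMap.rank (F : H →ₗ[ℂ] H) ≤ (k : Cardinal) → c ≤ ‖T - F‖) :
    c ≤ singularNumber T k :=
  le_csInf ⟨_, 0, rank_clm_zero_le k, rfl⟩ (by rintro _ ⟨F, hF, rfl⟩; exact h F hF)

theorem exists_rank_le_norm_sub_lt (T : H →L[ℂ] H) (k : ℕ) {ε : ℝ} (hε : 0 < ε) :
    ∃ F : H →L[ℂ] H, LinearMap.rank (F : H →ₗ[ℂ] H) ≤ (k : Cardinal) ∧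
      ‖T - F‖ < singularNumber T k + ε := by
  by_contra! h
  linarith [le_singularNumber T h]

theorem singularNumber_le_norm (T : H →L[ℂ] H) (k : ℕ) : singularNumber T k ≤ ‖T‖ := by
  simpa using singularNumber_le T (rank_clm_zero_le (H := H) k)

theorem singularNumber_antitone (T : H →L[ℂ] H) : Antitone (singularNumber T) := fun _ _ h =>
  le_singularNumber T fun _ hF => singularNumber_le T (hF.trans (by exact_mod_cast h))

theorem singularNumber_eq_zero_of_rank_le {T : H →L[ℂ] H} {k : ℕ}
    (hT : LinearMap.rank (T : H →ₗ[ℂ] H) ≤ (k : Cardinal)) : singularNumber T k = 0 :=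
  le_antisymm (by simpa using singularNumber_le T hT) (singularNumber_nonneg T k)

theorem rank_clm_add_le {F G : H →L[ℂ] H} {m n : ℕ}
    (hF : LinearMap.rank (F : H →ₗ[ℂ] H) ≤ (m : Cardinal))
    (hG : LinearMap.rank (G : H →ₗ[ℂ] H) ≤ (n : Cardinal)) :
    LinearMap.rank ((F + G : H →L[ℂ] H) : H →ₗ[ℂ] H) ≤ ((m + n : ℕ) : Cardinal) := by
  push_cast
  exact (LinearMap.rank_add_le _ _).trans (add_le_add hF hG)

theorem rank_clm_mul_le_left {F : H →L[ℂ] H} {m : ℕ}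
    (hF : LinearMap.rank (F : H →ₗ[ℂ] H) ≤ (m : Cardinal)) (G : H →L[ℂ] H) :
    LinearMap.rank ((F * G : H →L[ℂ] H) : H →ₗ[ℂ] H) ≤ (m : Cardinal) :=
  (LinearMap.rank_comp_le_left (G : H →ₗ[ℂ] H) (F : H →ₗ[ℂ] H)).trans hF

theorem rank_clm_mul_le_right {F : H →L[ℂ] H} {m : ℕ}
    (hF : LinearMap.rank (F : H →ₗ[ℂ] H) ≤ (m : Cardinal)) (G : H →L[ℂ] H) :
    LinearMap.rank ((G * F : H →L[ℂ] H) : H →ₗ[ℂ] H) ≤ (m : Cardinal) :=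
  (LinearMap.rank_comp_le_right (F : H →ₗ[ℂ] H) (G : H →ₗ[ℂ] H)).trans hF

theorem singularNumber_add_le (S T : H →L[ℂ] H) (m n : ℕ) :
    singularNumber (S + T) (m + n) ≤ singularNumber S m + singularNumber T n := by
  refine le_of_forall_pos_le_add fun ε hε => ?_
  obtain ⟨F, hF, hF'⟩ := exists_rank_le_norm_sub_lt S m (half_pos hε)
  obtain ⟨G, hG, hG'⟩ := exists_rank_le_norm_sub_lt T n (half_pos hε)
  have h1 := singularNumber_le (S + T) (rank_clm_add_le hF hG)
  have h2 : S + T - (F + G) = (S - F) + (T - G) := by abel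
  rw [h2] at h1
  linarith [norm_add_le (S - F) (T - G)]

theorem singularNumber_mul_left_le (A T : H →L[ℂ] H) (k : ℕ) :
    singularNumber (A * T) k ≤ ‖A‖ * singularNumber T k := by
  refine le_of_forall_pos_le_add fun ε hε => ?_
  have hA : 0 < ‖A‖ + 1 := by positivity
  obtain ⟨F, hF, hF'⟩ := exists_rank_le_norm_sub_lt T k (div_pos hε hA)
  have h1 := singularNumber_le (A * T) (rank_clm_mul_le_right hF A)
  rw [← mul_sub] at h1
  calc singularNumber (A * T) k ≤ ‖A‖ * ‖T - F‖ := h1.trans (norm_mul_le _ _)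
    _ ≤ ‖A‖ * (singularNumber T k + ε / (‖A‖ + 1)) := by gcongr
    _ ≤ _ := by
      rw [mul_add]
      gcongr
      rw [mul_div_assoc', div_le_iff₀ hA]
      nlinarith [norm_nonneg A]

theorem singularNumber_mul_le (S T : H →L[ℂ] H) (m n : ℕ) :
    singularNumber (S * T) (m + n) ≤ singularNumber S m * singularNumber T n := by
  have key : ∀ ε > 0, singularNumber (S * T) (m + n) ≤
      (singularNumber S m + ε) * (singularNumber T n + ε) := fun ε hε => by
    obtain ⟨F, hF, hF'⟩ := exists_rank_le_norm_sub_lt S m hε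
    obtain ⟨G, hG, hG'⟩ := exists_rank_le_norm_sub_lt T n hε
    have h1 := singularNumber_le (S * T)
      (rank_clm_add_le (rank_clm_mul_le_left hF T) (rank_clm_mul_le_right hG (S - F)))
    have h2 : S * T - (F * T + (S - F) * G) = (S - F) * (T - G) := by noncomm_ring
    rw [h2] at h1
    refine (h1.trans (norm_mul_le _ _)).trans ?_
    have := singularNumber_nonneg S m
    gcongr
  have hlim : Filter.Tendsto
      (fun ε : ℝ => (singularNumber S m + ε) * (singularNumber T n + ε))
      (nhdsWithin 0 (Set.Ioi 0)) (nhds ((singularNumber S m + 0) * (singularNumber T n + 0))) :=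
    Filter.Tendsto.mono_left (Continuous.tendsto (by fun_prop) 0) nhdsWithin_le_nhds
  simp only [add_zero] at hlim
  exact ge_of_tendsto hlim (by filter_upwards [self_mem_nhdsWithin] with ε hε using key ε hε)

theorem singularNumber_smul_le (c : ℂ) (T : H →L[ℂ] H) (k : ℕ) :
    singularNumber (c • T) k ≤ ‖c‖ * singularNumber T k := by
  have h := singularNumber_mul_left_le (c • (1 : H →L[ℂ] H)) T k
  rw [smul_mul_assoc, one_mul] at h
  refine h.trans (mul_le_mul_of_nonneg_right ?_ (singularNumber_nonneg T k))
  rw [norm_smul]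
  exact mul_le_of_le_one_right (norm_nonneg _) ContinuousLinearMap.norm_id_le

theorem singularNumber_smul (c : ℂ) (T : H →L[ℂ] H) (k : ℕ) :
    singularNumber (c • T) k = ‖c‖ * singularNumber T k := by
  rcases eq_or_ne c 0 with rfl | hc
  · simpa using singularNumber_eq_zero_of_rank_le (rank_clm_zero_le (H := H) k)
  refine le_antisymm (singularNumber_smul_le c T k) ?_
  have h := singularNumber_smul_le c⁻¹ (c • T) k
  rw [inv_smul_smul₀ hc, norm_inv, ← div_eq_inv_mul, le_div_iff₀ (norm_pos_iff.2 hc)] at h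
  linarith

theorem singularNumber_neg (T : H →L[ℂ] H) (k : ℕ) :
    singularNumber (-T) k = singularNumber T k := by
  simpa using singularNumber_smul (-1) T k

/-- A bound of order `(m + 1)^{-p}` for the singular numbers of even index `m + m` extends to all
indices, since the singular numbers decrease. -/
theorem singularNumber_le_of_double {T : H →L[ℂ] H} {p C : ℝ} (hp : 0 ≤ p)
    (h : ∀ m : ℕ, singularNumber T (m + m) ≤ C * ((m : ℝ) + 1) ^ (-p)) (k : ℕ) :
    singularNumber T k ≤ C * 2 ^ p * ((k : ℝ) + 1) ^ (-p) := by
  have hC : 0 ≤ C := by simpa using (singularNumber_nonneg T (0 + 0)).trans (h 0)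
  have h1 : singularNumber T k ≤ singularNumber T (k / 2 + k / 2) :=
    singularNumber_antitone T (by omega)
  have h2 : ((k : ℝ) + 1) / 2 ≤ ((k / 2 : ℕ) : ℝ) + 1 := by
    have : k + 1 ≤ 2 * (k / 2 + 1) := by omega
    have : ((k : ℝ) + 1) ≤ 2 * (((k / 2 : ℕ) : ℝ) + 1) := by exact_mod_cast this
    linarith
  refine (h1.trans (h _)).trans ?_
  rw [mul_assoc]
  refine mul_le_mul_of_nonneg_left ?_ hC
  calc (((k / 2 : ℕ) : ℝ) + 1) ^ (-p) ≤ (((k : ℝ) + 1) / 2) ^ (-p) :=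
        Real.rpow_le_rpow_of_nonpos (by positivity) h2 (by linarith)
    _ = 2 ^ p * ((k : ℝ) + 1) ^ (-p) := by
        rw [Real.div_rpow (by positivity) (by norm_num), Real.rpow_neg (by norm_num : (0:ℝ) ≤ 2)]
        field_simp

variable [CompleteSpace H]

theorem rank_star_le {F : H →L[ℂ] H} {k : ℕ}
    (hF : LinearMap.rank (F : H →ₗ[ℂ] H) ≤ (k : Cardinal)) :
    LinearMap.rank ((star F : H →L[ℂ] H) : H →ₗ[ℂ] H) ≤ (k : Cardinal) := by
  set V := LinearMap.range (F : H →ₗ[ℂ] H) with hV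
  have : FiniteDimensional ℂ V :=
    Module.rank_lt_aleph0_iff.1 (lt_of_le_of_lt hF (Cardinal.natCast_lt_aleph0))
  have h1 : V.starProjection * F = F := by
    ext x
    exact Submodule.starProjection_eq_self_iff.2 ⟨x, rfl⟩
  have hs : star V.starProjection = V.starProjection := (isSelfAdjoint_starProjection V)
  rw [← h1, star_mul, hs]
  refine rank_clm_mul_le_right ?_ _
  have h2 : LinearMap.range ((V.starProjection : H →L[ℂ] H) : H →ₗ[ℂ] H) = V :=
    Submodule.range_starProjection V
  rw [LinearMap.rank, h2]
  exact hF

theorem singularNumber_star_le (T : H →L[ℂ] H) (k : ℕ) :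
    singularNumber (star T) k ≤ singularNumber T k :=
  le_singularNumber T fun F hF => by
    simpa [← star_sub] using singularNumber_le (star T) (rank_star_le hF)

theorem singularNumber_star (T : H →L[ℂ] H) (k : ℕ) :
    singularNumber (star T) k = singularNumber T k :=
  le_antisymm (singularNumber_star_le T k) (by simpa using singularNumber_star_le (star T) k)

theorem singularNumber_mul_right_le (T A : H →L[ℂ] H) (k : ℕ) :
    singularNumber (T * A) k ≤ ‖A‖ * singularNumber T k := by
  have h := singularNumber_mul_left_le (star A) (star T) k
  rwa [← star_mul, singularNumber_star, singularNumber_star, norm_star] at h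

theorem singularNumber_unitary_conj (U : unitary (H →L[ℂ] H)) (T : H →L[ℂ] H) (k : ℕ) :
    singularNumber ((U : H →L[ℂ] H) * T * star (U : H →L[ℂ] H)) k = singularNumber T k := by
  have key : ∀ (V : unitary (H →L[ℂ] H)) (S : H →L[ℂ] H),
      singularNumber ((V : H →L[ℂ] H) * S * star (V : H →L[ℂ] H)) k ≤ singularNumber S k := by
    intro V S
    have hV : ‖(V : H →L[ℂ] H)‖ ≤ 1 := by
      rcases subsingleton_or_nontrivial (H →L[ℂ] H) with _ | _
      · simp [Subsingleton.elim (V : H →L[ℂ] H) 0]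
      · exact (CStarRing.norm_coe_unitary V).le
    have hV' : ‖star (V : H →L[ℂ] H)‖ ≤ 1 := by rwa [norm_star]
    have h0 := singularNumber_nonneg S k
    have h1 := singularNumber_nonneg ((V : H →L[ℂ] H) * S) k
    have h2 := singularNumber_mul_left_le (V : H →L[ℂ] H) S k
    have h3 := singularNumber_mul_right_le ((V : H →L[ℂ] H) * S) (star (V : H →L[ℂ] H)) k
    nlinarith
  refine le_antisymm (key U T) ?_
  have h := key (star U) ((U : H →L[ℂ] H) * T * star (U : H →L[ℂ] H))
  have e : ((star U : unitary (H →L[ℂ] H)) : H →L[ℂ] H) *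
      ((U : H →L[ℂ] H) * T * star (U : H →L[ℂ] H)) *
      star ((star U : unitary (H →L[ℂ] H)) : H →L[ℂ] H) = T := by
    rw [Unitary.coe_star, star_star]
    calc _ = (star (U : H →L[ℂ] H) * U) * T * (star (U : H →L[ℂ] H) * U) := by noncomm_ring
      _ = T := by simp
  rwa [e] at h

/-- The positive part is obtained from a self-adjoint operator by compressing with the projection
onto the closure of the range of the positive part, so its singular numbers are no larger. -/
theorem singularNumber_posPart_le {T : H →L[ℂ] H} (hT : IsSelfAdjoint T) (k : ℕ) :
    singularNumber T⁺ k ≤ singularNumber T k := by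
  set V := (LinearMap.range (T⁺ : H →L[ℂ] H).toLinearMap).topologicalClosure with hV
  have h1 : V.starProjection * T⁺ = T⁺ := by
    ext x
    exact Submodule.starProjection_eq_self_iff.2
      (Submodule.le_topologicalClosure _ ⟨x, rfl⟩)
  have h2 : T⁻ * V.starProjection = 0 := by
    have hle : V ≤ LinearMap.ker (T⁻ : H →L[ℂ] H).toLinearMap := by
      refine Submodule.topologicalClosure_minimal _ ?_ (T⁻ : H →L[ℂ] H).isClosed_ker
      rintro _ ⟨x, rfl⟩
      exact congrArg (fun S : H →L[ℂ] H => S x) (CFC.negPart_mul_posPart T)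
    ext x
    exact hle (Submodule.starProjection_apply_mem V x)
  have h3 : V.starProjection * T⁻ = 0 := by
    have h := congrArg star h2
    rwa [star_mul, star_zero, (isSelfAdjoint_starProjection V).star_eq,
      (CFC.negPart_nonneg T).isSelfAdjoint.star_eq] at h
  have h4 : V.starProjection * T = T⁺ := by
    calc V.starProjection * T = V.starProjection * (T⁺ - T⁻) :=
          congrArg _ (CFC.posPart_sub_negPart T hT).symm
      _ = T⁺ := by rw [mul_sub, h1, h3, sub_zero]
  rw [← h4]
  exact (singularNumber_mul_left_le _ _ _).trans
    (mul_le_of_le_one_left (singularNumber_nonneg _ _) (Submodule.starProjection_norm_le V))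

theorem singularNumber_negPart_le {T : H →L[ℂ] H} (hT : IsSelfAdjoint T) (k : ℕ) :
    singularNumber T⁻ k ≤ singularNumber T k := by
  have h := singularNumber_posPart_le hT.neg k
  rwa [CFC.posPart_neg, singularNumber_neg] at h

/-! ### Operators with singular numbers of order `k ^ (-p)` -/

/-- The operators with `μ_k(T) = O((k + 1)^{-p})`, the weak Schatten class of exponent `1 / p`. -/
def weakSchatten (H : Type*) [NormedAddCommGroup H] [InnerProductSpace ℂ H] [CompleteSpace H]
    (p : ℝ) : Set (H →L[ℂ] H) :=
  {T | ∃ C : ℝ, ∀ k : ℕ, singularNumber T k ≤ C * ((k : ℝ) + 1) ^ (-p)}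

theorem weakSchatten_zero (T : H →L[ℂ] H) : T ∈ weakSchatten H 0 :=
  ⟨‖T‖, fun k => by simpa using singularNumber_le_norm T k⟩

theorem mem_weakSchatten_of_double {T : H →L[ℂ] H} {p C : ℝ} (hp : 0 ≤ p)
    (h : ∀ m : ℕ, singularNumber T (m + m) ≤ C * ((m : ℝ) + 1) ^ (-p)) :
    T ∈ weakSchatten H p :=
  ⟨C * 2 ^ p, singularNumber_le_of_double hp h⟩

theorem weakSchatten_add {p : ℝ} (hp : 0 ≤ p) {S T : H →L[ℂ] H} (hS : S ∈ weakSchatten H p)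
    (hT : T ∈ weakSchatten H p) : S + T ∈ weakSchatten H p := by
  obtain ⟨C, hC⟩ := hS
  obtain ⟨C', hC'⟩ := hT
  refine mem_weakSchatten_of_double hp (C := C + C') fun m => ?_
  linarith [singularNumber_add_le S T m m, hC m, hC' m]

theorem weakSchatten_mul {p q : ℝ} (hp : 0 ≤ p) (hq : 0 ≤ q) {S T : H →L[ℂ] H}
    (hS : S ∈ weakSchatten H p) (hT : T ∈ weakSchatten H q) : S * T ∈ weakSchatten H (p + q) := by
  obtain ⟨C, hC⟩ := hS
  obtain ⟨C', hC'⟩ := hT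
  refine mem_weakSchatten_of_double (add_nonneg hp hq) (C := C * C') fun m => ?_
  refine (singularNumber_mul_le S T m m).trans ?_
  refine (mul_le_mul (hC m) (hC' m) (singularNumber_nonneg _ _)
    ((singularNumber_nonneg _ _).trans (hC m))).trans (le_of_eq ?_)
  rw [neg_add, Real.rpow_add (by positivity)]
  ring

theorem weakSchatten_mul_left {p : ℝ} (hp : 0 ≤ p) (A : H →L[ℂ] H) {T : H →L[ℂ] H}
    (hT : T ∈ weakSchatten H p) : A * T ∈ weakSchatten H p := by
  simpa using weakSchatten_mul le_rfl hp (weakSchatten_zero A) hT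

theorem weakSchatten_mul_right {p : ℝ} (hp : 0 ≤ p) {T : H →L[ℂ] H}
    (hT : T ∈ weakSchatten H p) (A : H →L[ℂ] H) : T * A ∈ weakSchatten H p := by
  simpa using weakSchatten_mul hp le_rfl hT (weakSchatten_zero A)

theorem weakSchatten_smul {p : ℝ} (c : ℂ) {T : H →L[ℂ] H}
    (hT : T ∈ weakSchatten H p) : c • T ∈ weakSchatten H p := by
  obtain ⟨C, hC⟩ := hT
  refine ⟨‖c‖ * C, fun k => ?_⟩
  rw [singularNumber_smul, mul_assoc]
  exact mul_le_mul_of_nonneg_left (hC k) (norm_nonneg c)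

theorem weakSchatten_neg {p : ℝ} {T : H →L[ℂ] H} (hT : T ∈ weakSchatten H p) :
    -T ∈ weakSchatten H p := by
  simpa using weakSchatten_smul (-1) hT

theorem weakSchatten_sub {p : ℝ} (hp : 0 ≤ p) {S T : H →L[ℂ] H} (hS : S ∈ weakSchatten H p)
    (hT : T ∈ weakSchatten H p) : S - T ∈ weakSchatten H p := by
  rw [sub_eq_add_neg]
  exact weakSchatten_add hp hS (weakSchatten_neg hT)

theorem weakSchatten_posPart {p : ℝ} {T : H →L[ℂ] H} (h : IsSelfAdjoint T)
    (hT : T ∈ weakSchatten H p) : T⁺ ∈ weakSchatten H p := by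
  obtain ⟨C, hC⟩ := hT
  exact ⟨C, fun k => (singularNumber_posPart_le h k).trans (hC k)⟩

theorem weakSchatten_negPart {p : ℝ} {T : H →L[ℂ] H} (h : IsSelfAdjoint T)
    (hT : T ∈ weakSchatten H p) : T⁻ ∈ weakSchatten H p := by
  obtain ⟨C, hC⟩ := hT
  exact ⟨C, fun k => (singularNumber_negPart_le h k).trans (hC k)⟩

theorem weakSchatten_of_rank_le {p : ℝ} (hp : 0 ≤ p) {T : H →L[ℂ] H} {n : ℕ}
    (hT : LinearMap.rank (T : H →ₗ[ℂ] H) ≤ (n : Cardinal)) : T ∈ weakSchatten H p := by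
  refine ⟨‖T‖ * ((n : ℝ) + 1) ^ p, fun k => ?_⟩
  rcases le_or_gt n k with h | h
  · rw [singularNumber_eq_zero_of_rank_le (hT.trans (by exact_mod_cast h))]
    positivity
  · refine (singularNumber_le_norm T k).trans ?_
    rw [mul_assoc]
    refine le_mul_of_one_le_right (norm_nonneg T) ?_
    have h1 : ((k : ℝ) + 1) ^ p ≤ ((n : ℝ) + 1) ^ p := by
      gcongr
    rw [Real.rpow_neg (by positivity), ← div_eq_mul_inv, one_le_div (by positivity)]
    exact h1

end SingularNumbers

/-! ### Ky Fan inequalities for positive operators -/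

section KyFan

variable {H : Type*} [NormedAddCommGroup H] [InnerProductSpace ℂ H]

/-- The compression `P T P` of `T` to a finite-dimensional subspace, as an endomorphism of it. -/
noncomputable def compression (V : Submodule ℂ H) [FiniteDimensional ℂ V] (T : H →L[ℂ] H) :
    V →ₗ[ℂ] V :=
  (V.orthogonalProjectionOnto : H →ₗ[ℂ] V) ∘ₗ (T : H →ₗ[ℂ] H) ∘ₗ V.subtype

theorem inner_compression (V : Submodule ℂ H) [FiniteDimensional ℂ V] (T : H →L[ℂ] H) (u v : V) :
    inner ℂ u (compression V T v) = inner ℂ (u : H) (T v) :=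
  V.inner_orthogonalProjectionOnto_eq_of_mem_left u (T v)

theorem compression_add (V : Submodule ℂ H) [FiniteDimensional ℂ V] (S T : H →L[ℂ] H) :
    compression V (S + T) = compression V S + compression V T := by
  ext x
  simp [compression]

theorem compression_isSymmetric (V : Submodule ℂ H) [FiniteDimensional ℂ V] {T : H →L[ℂ] H}
    (hT : (T : H →ₗ[ℂ] H).IsSymmetric) : (compression V T).IsSymmetric := fun u v => by
  rw [inner_compression, ← inner_conj_symm, inner_compression, inner_conj_symm]
  exact hT u v

theorem sum_inner_le_trace_compression (V : Submodule ℂ H) [FiniteDimensional ℂ V]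
    {T : H →L[ℂ] H} (hT : 0 ≤ T) {s : Finset H}
    (hs : Orthonormal ℂ (Subtype.val : ↥(s : Set H) → H)) (hsV : ∀ x ∈ s, x ∈ V) :
    ∑ x ∈ s, (inner ℂ x (T x)).re ≤ (LinearMap.trace ℂ V (compression V T)).re := by
  classical
  have hv : Orthonormal ℂ ((↑) : ((↑) ⁻¹' (s : Set H) : Set V) → V) := by
    rw [orthonormal_subtype_iff_ite] at hs ⊢
    intro v hv w hw
    have h := hs v hv w hw
    rw [Submodule.coe_inner, h]
    simp
  obtain ⟨u, b, hu, hb⟩ := hv.exists_orthonormalBasis_extension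
  have hpos := (ContinuousLinearMap.nonneg_iff_isPositive T).1 hT
  rw [LinearMap.trace_eq_sum_inner _ b, Complex.re_sum]
  calc ∑ x ∈ s, (inner ℂ x (T x)).re
      ≤ ∑ x ∈ u.map (Function.Embedding.subtype (· ∈ V)), (inner ℂ x (T x)).re := by
        refine Finset.sum_le_sum_of_subset_of_nonneg ?_ fun x _ _ => hpos.re_inner_nonneg_right x
        intro x hx
        exact Finset.mem_map.2 ⟨⟨x, hsV x hx⟩, hu hx, rfl⟩
    _ = ∑ v ∈ u, (inner ℂ (v : H) (T v)).re := by simp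
    _ = ∑ i : u, (inner ℂ (b i) (compression V T (b i))).re := by
        rw [← Finset.sum_coe_sort]
        refine Finset.sum_congr rfl fun i _ => ?_
        rw [inner_compression, hb]
    _ ≤ _ := le_rfl

/-- The `i`-th largest eigenvalue of a compression is at most the `i`-th singular number: an
operator of rank `i` kills a nonzero combination of the first `i + 1` eigenvectors. -/
theorem eigenvalue_compression_le (V : Submodule ℂ H) [FiniteDimensional ℂ V] {T : H →L[ℂ] H}
    (hT : (compression V T).IsSymmetric) {n : ℕ} (hn : Module.finrank ℂ V = n) (i : Fin n) :
    hT.eigenvalues hn i ≤ singularNumber T i := by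
  refine le_singularNumber T fun F hF => ?_
  set W := LinearMap.range (F : H →ₗ[ℂ] H) with hW
  have hWfin : FiniteDimensional ℂ W :=
    Module.rank_lt_aleph0_iff.1 (lt_of_le_of_lt hF (Cardinal.natCast_lt_aleph0))
  have hWrank : Module.finrank ℂ W ≤ i := Module.finrank_le_of_rank_le hF
  let e : Fin (i + 1) → Fin n := Fin.castLE i.2
  have he : Function.Injective e := Fin.castLE_injective i.2
  set b := hT.eigenvectorBasis hn with hb
  have hon : Orthonormal ℂ (b ∘ e) := b.orthonormal.comp e he
  have hdep : ¬ LinearIndependent ℂ fun j => (⟨F (b (e j)), ⟨_, rfl⟩⟩ : W) := fun h => by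
    have := h.fintype_card_le_finrank
    simp only [Fintype.card_fin] at this
    omega
  obtain ⟨g, hg, j₀, hj₀⟩ := Fintype.not_linearIndependent_iff.1 hdep
  set x : V := ∑ j, g j • b (e j) with hx
  have hFx : F x = 0 := by
    have h := congrArg (Subtype.val : W → H) hg
    simpa [hx, map_sum] using h
  have hxx : inner ℂ x x = ∑ j, (starRingEnd ℂ) (g j) * g j := hon.inner_sum g g Finset.univ
  have hCx : compression V T x = ∑ j, (g j * (hT.eigenvalues hn (e j) : ℂ)) • b (e j) := by
    rw [hx, map_sum]
    refine Finset.sum_congr rfl fun j _ => ?_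
    rw [map_smul, hb, hT.apply_eigenvectorBasis hn, smul_smul]
    rfl
  have hxCx : inner ℂ x (compression V T x) =
      ∑ j, (starRingEnd ℂ) (g j) * (g j * (hT.eigenvalues hn (e j) : ℂ)) := by
    rw [hCx]
    exact hon.inner_sum g _ Finset.univ
  have hnorm : ‖x‖ ^ 2 = ∑ j, ‖g j‖ ^ 2 := by
    have h := inner_self_eq_norm_sq_to_K (𝕜 := ℂ) x
    rw [hxx] at h
    have h' := congrArg Complex.re h
    simp only [Complex.re_sum, Complex.conj_mul'] at h'
    norm_cast at h'
    exact h'.symm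
  have hlow : hT.eigenvalues hn i * ‖x‖ ^ 2 ≤ (inner ℂ x (compression V T x)).re := by
    rw [hxCx, hnorm, Finset.mul_sum, Complex.re_sum]
    refine Finset.sum_le_sum fun j _ => ?_
    rw [← mul_assoc, Complex.conj_mul']
    norm_cast
    rw [mul_comm]
    gcongr
    exact hT.eigenvalues_antitone hn (Fin.le_def.2 (Nat.lt_succ_iff.1 j.2))
  have hup : (inner ℂ x (compression V T x)).re ≤ ‖T - F‖ * ‖x‖ ^ 2 := by
    rw [inner_compression]
    have h1 : T x = (T - F) x := by simp [hFx]
    rw [h1]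
    calc _ ≤ ‖inner ℂ (x : H) ((T - F) x)‖ := Complex.re_le_norm _
      _ ≤ ‖(x : H)‖ * ‖(T - F) x‖ := norm_inner_le_norm _ _
      _ ≤ ‖(x : H)‖ * (‖T - F‖ * ‖(x : H)‖) := by gcongr; exact (T - F).le_opNorm _
      _ = _ := by rw [Submodule.coe_norm]; ring
  have hpos : 0 < ‖x‖ ^ 2 := by
    rw [hnorm]
    refine Finset.sum_pos' (fun _ _ => by positivity) ⟨j₀, Finset.mem_univ _, ?_⟩
    have := norm_pos_iff.2 hj₀
    positivity
  exact le_of_mul_le_mul_right (hlow.trans hup) hpos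

theorem trace_compression_le (V : Submodule ℂ H) [FiniteDimensional ℂ V] {T : H →L[ℂ] H}
    (hT : 0 ≤ T) {N : ℕ} (hV : Module.finrank ℂ V ≤ N) :
    (LinearMap.trace ℂ V (compression V T)).re ≤ ∑ k ∈ Finset.range N, singularNumber T k := by
  have hsym : (compression V T).IsSymmetric :=
    compression_isSymmetric V ((ContinuousLinearMap.nonneg_iff_isPositive T).1 hT).isSymmetric
  have h := hsym.re_trace_eq_sum_eigenvalues rfl
  change (LinearMap.trace ℂ V (compression V T)).re = _ at h
  rw [h]
  calc _ ≤ ∑ i : Fin (Module.finrank ℂ V), singularNumber T i :=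
        Finset.sum_le_sum fun i _ => eigenvalue_compression_le V hsym rfl i
    _ = ∑ k ∈ Finset.range (Module.finrank ℂ V), singularNumber T k :=
        Fin.sum_univ_eq_sum_range (singularNumber T) _
    _ ≤ _ := Finset.sum_le_sum_of_subset_of_nonneg
        (Finset.range_mono hV) fun _ _ _ => singularNumber_nonneg _ _

theorem sum_inner_le_sum_singularNumber {T : H →L[ℂ] H} (hT : 0 ≤ T) {s : Finset H}
    (hs : Orthonormal ℂ (Subtype.val : ↥(s : Set H) → H)) {N : ℕ} (hN : s.card ≤ N) :
    ∑ x ∈ s, (inner ℂ x (T x)).re ≤ ∑ k ∈ Finset.range N, singularNumber T k :=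
  (sum_inner_le_trace_compression (Submodule.span ℂ (s : Set H)) hT hs
    fun _ hx => Submodule.subset_span hx).trans
    (trace_compression_le _ hT ((finrank_span_finset_le_card s).trans hN))

variable [CompleteSpace H]

/-- If `T ≥ 0` is at most `c` on the orthogonal complement of `V`, with `dim V ≤ k`, then
`μ_k(T) ≤ c`; the approximating operator of rank at most `k` is `√T P √T`, with `P` the projection
onto `V`. -/
theorem singularNumber_le_of_orthogonal (V : Submodule ℂ H) [FiniteDimensional ℂ V]
    {T : H →L[ℂ] H} (hT : 0 ≤ T) {k : ℕ} (hV : Module.finrank ℂ V ≤ k) {c : ℝ} (hc : 0 ≤ c)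
    (h : ∀ x ∈ Vᗮ, (inner ℂ x (T x)).re ≤ c * ‖x‖ ^ 2) : singularNumber T k ≤ c := by
  set S := CFC.sqrt T with hS
  have hSS : S * S = T := CFC.sqrt_mul_sqrt_self T hT
  have hSsa : star S = S := (CFC.sqrt_nonneg T).isSelfAdjoint.star_eq
  set P : H →L[ℂ] H := V.starProjection with hP
  have hPsa : star P = P := isSelfAdjoint_starProjection V
  have hPP : P * P = P := V.isIdempotentElem_starProjection
  have hrank : LinearMap.rank (P : H →ₗ[ℂ] H) ≤ (k : Cardinal) := by
    have h2 : LinearMap.range (P : H →ₗ[ℂ] H) = V := Submodule.range_starProjection V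
    rw [LinearMap.rank, h2, ← Module.finrank_eq_rank]
    exact_mod_cast hV
  have h1 := singularNumber_le T (rank_clm_mul_le_left (rank_clm_mul_le_right hrank S) S)
  set B := S * (1 - P) with hB
  have h2 : T - S * P * S = B * star B := by
    rw [hB, star_mul, hSsa, star_sub, star_one, hPsa, ← hSS]
    have : (1 - P) * (1 - P) = 1 - P := (IsIdempotentElem.one_sub hPP).eq
    calc S * S - S * P * S = S * (1 - P) * S := by noncomm_ring
      _ = S * ((1 - P) * (1 - P)) * S := by rw [this]
      _ = _ := by noncomm_ring
  rw [h2, CStarRing.norm_self_mul_star] at h1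
  have h3 : ‖B‖ ≤ Real.sqrt c := by
    refine ContinuousLinearMap.opNorm_le_bound _ (Real.sqrt_nonneg _) fun x => ?_
    set y := (1 - P) x with hy
    have hyV : y ∈ Vᗮ := V.sub_starProjection_mem_orthogonal x
    have hynorm : ‖y‖ ≤ ‖x‖ := by
      have : y = Vᗮ.starProjection x := by rw [V.starProjection_orthogonal']
      rw [this]
      exact Vᗮ.norm_starProjection_apply_le x
    have hBx : ‖B x‖ ^ 2 = (inner ℂ y (T y)).re := by
      have e1 : B x = S y := rfl
      have e2 : inner ℂ (S y) (S y) = inner ℂ y (T y) := by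
        rw [← hSS, ← ContinuousLinearMap.adjoint_inner_right]
        change inner ℂ y ((star S) (S y)) = _
        rw [hSsa]
        rfl
      rw [e1, ← e2]
      exact norm_sq_eq_re_inner (𝕜 := ℂ) (S y)
    have hle : ‖B x‖ ^ 2 ≤ c * ‖x‖ ^ 2 := by
      rw [hBx]
      exact (h y hyV).trans (by gcongr)
    rw [← Real.sqrt_sq (norm_nonneg x), ← Real.sqrt_mul hc]
    exact Real.le_sqrt_of_sq_le hle
  calc singularNumber T k ≤ ‖B‖ * ‖B‖ := h1
    _ ≤ Real.sqrt c * Real.sqrt c := by gcongr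
    _ = c := Real.mul_self_sqrt hc

/-- Greedy choice: orthonormal vectors almost attaining the sum of the first `N` singular numbers
of a positive operator. -/
theorem exists_orthonormal_sum_singularNumber_le {T : H →L[ℂ] H} (hT : 0 ≤ T) {ε : ℝ}
    (hε : 0 < ε) (N : ℕ) :
    ∃ s : Finset H, Orthonormal ℂ (Subtype.val : ↥(s : Set H) → H) ∧ s.card ≤ N ∧
      ∑ k ∈ Finset.range N, singularNumber T k ≤ ∑ x ∈ s, (inner ℂ x (T x)).re + N * ε := by
  classical
  induction N with
  | zero => exact ⟨∅, by simp, by simp, by simp⟩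
  | succ N ih =>
    obtain ⟨s, hs, hcard, hsum⟩ := ih
    rw [Finset.sum_range_succ]
    push_cast
    by_cases hμ : singularNumber T N ≤ ε
    · exact ⟨s, hs, hcard.trans (Nat.le_succ N), by linarith⟩
    push Not at hμ
    set V := Submodule.span ℂ (s : Set H) with hV
    obtain ⟨y, hyV, hy⟩ : ∃ y ∈ Vᗮ, (singularNumber T N - ε) * ‖y‖ ^ 2 <
        (inner ℂ y (T y)).re := by
      by_contra! hcon
      have := singularNumber_le_of_orthogonal V hT ((finrank_span_finset_le_card s).trans hcard)
        (by linarith) hcon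
      linarith
    have hy0 : y ≠ 0 := by rintro rfl; simp at hy
    have hyn : 0 < ‖y‖ := norm_pos_iff.2 hy0
    set x : H := ((‖y‖⁻¹ : ℝ) : ℂ) • y with hx
    have hxn : ‖x‖ = 1 := by
      rw [hx, norm_smul, Complex.norm_real, norm_inv, norm_norm, inv_mul_cancel₀ hyn.ne']
    have hxV : x ∈ Vᗮ := Submodule.smul_mem _ _ hyV
    have hxT : singularNumber T N - ε ≤ (inner ℂ x (T x)).re := by
      have e : (inner ℂ x (T x)).re = ‖y‖⁻¹ ^ 2 * (inner ℂ y (T y)).re := by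
        rw [hx, map_smul, inner_smul_left, inner_smul_right, Complex.conj_ofReal,
          Complex.re_ofReal_mul, Complex.re_ofReal_mul]
        ring
      rw [e, inv_pow, ← div_eq_inv_mul, le_div_iff₀ (by positivity)]
      exact hy.le
    have hxs : x ∉ s := fun hmem => by
      have h0 : inner ℂ x x = 0 := hxV x (Submodule.subset_span hmem)
      rw [inner_self_eq_norm_sq_to_K, hxn] at h0
      simp at h0
    refine ⟨insert x s, ?_, ?_, ?_⟩
    · rw [orthonormal_subtype_iff_ite] at hs ⊢
      have hxx : inner ℂ x x = 1 := by rw [inner_self_eq_norm_sq_to_K, hxn]; simp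
      have hvx : ∀ v ∈ s, inner ℂ v x = 0 := fun v hv => hxV v (Submodule.subset_span hv)
      intro v hv w hw
      rw [Finset.coe_insert, Set.mem_insert_iff, Finset.mem_coe] at hv hw
      rcases hv with rfl | hv <;> rcases hw with rfl | hw
      · rw [if_pos rfl, hxx]
      · rw [if_neg (ne_of_mem_of_not_mem hw hxs).symm, ← inner_conj_symm, hvx w hw, map_zero]
      · rw [if_neg (ne_of_mem_of_not_mem hv hxs), hvx v hv]
      · exact hs v hv w hw
    · rw [Finset.card_insert_of_notMem hxs]
      omega
    · rw [Finset.sum_insert hxs]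
      linarith

theorem sum_singularNumber_add_le {S T : H →L[ℂ] H} (hS : 0 ≤ S) (hT : 0 ≤ T) (N : ℕ) :
    ∑ k ∈ Finset.range N, singularNumber (S + T) k ≤
      ∑ k ∈ Finset.range N, singularNumber S k + ∑ k ∈ Finset.range N, singularNumber T k := by
  refine le_of_forall_pos_le_add fun ε hε => ?_
  obtain ⟨s, hs, hcard, hsum⟩ := exists_orthonormal_sum_singularNumber_le (add_nonneg hS hT)
    (ε := ε / (N + 1)) (by positivity) N
  have h1 := sum_inner_le_sum_singularNumber hS hs hcard
  have h2 := sum_inner_le_sum_singularNumber hT hs hcard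
  have h3 : ∑ x ∈ s, (inner ℂ x ((S + T) x)).re =
      ∑ x ∈ s, (inner ℂ x (S x)).re + ∑ x ∈ s, (inner ℂ x (T x)).re := by
    rw [← Finset.sum_add_distrib]
    simp
  have h4 : (N : ℝ) * (ε / (N + 1)) ≤ ε := by
    rw [mul_div_assoc', div_le_iff₀ (by positivity)]
    nlinarith
  linarith

theorem sum_singularNumber_add_ge {S T : H →L[ℂ] H} (hS : 0 ≤ S) (hT : 0 ≤ T) (N : ℕ) :
    ∑ k ∈ Finset.range N, singularNumber S k + ∑ k ∈ Finset.range N, singularNumber T k ≤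
      ∑ k ∈ Finset.range (2 * N), singularNumber (S + T) k := by
  classical
  refine le_of_forall_pos_le_add fun ε hε => ?_
  have hε' : 0 < ε / (2 * (N + 1)) := by positivity
  obtain ⟨s, hs, hscard, hssum⟩ := exists_orthonormal_sum_singularNumber_le hS hε' N
  obtain ⟨t, ht, htcard, htsum⟩ := exists_orthonormal_sum_singularNumber_le hT hε' N
  set V := Submodule.span ℂ ((s ∪ t : Finset H) : Set H) with hV
  have hdim : Module.finrank ℂ V ≤ 2 * N :=
    (finrank_span_finset_le_card _).trans ((Finset.card_union_le s t).trans (by omega))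
  have h1 := sum_inner_le_trace_compression V hS hs
    fun x hx => Submodule.subset_span (by simp [Finset.mem_coe.1 hx])
  have h2 := sum_inner_le_trace_compression V hT ht
    fun x hx => Submodule.subset_span (by simp [Finset.mem_coe.1 hx])
  have h3 := trace_compression_le V (add_nonneg hS hT) hdim
  rw [compression_add, map_add, Complex.add_re] at h3
  have h4 : (N : ℝ) * (ε / (2 * (N + 1))) ≤ ε / 2 := by
    rw [mul_div_assoc', div_le_div_iff₀ (by positivity) (by positivity)]
    nlinarith
  linarith

end KyFan

/-! ### Generalized limits -/

section GeneralizedLimit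

variable (ω : DixmierLimit)

theorem DixmierLimit.lim_eq {s : ℕ → ℝ} {C : ℝ} (h : ∀ n, ‖s n‖ ≤ C) :
    ω.lim s =
      ω.toLinearMap (BoundedContinuousFunction.ofNormedAddCommGroupDiscrete s C h) := by
  have h' : ∃ C : ℝ, ∀ n, ‖s n‖ ≤ C := ⟨C, h⟩
  rw [DixmierLimit.lim, dif_pos h']
  congr 1

theorem DixmierLimit.lim_add {s t : ℕ → ℝ} (hs : ∃ C : ℝ, ∀ n, ‖s n‖ ≤ C)
    (ht : ∃ C : ℝ, ∀ n, ‖t n‖ ≤ C) : ω.lim (fun n => s n + t n) = ω.lim s + ω.lim t := by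
  obtain ⟨C, hC⟩ := hs
  obtain ⟨C', hC'⟩ := ht
  have h : ∀ n, ‖s n + t n‖ ≤ C + C' := fun n =>
    (norm_add_le _ _).trans (add_le_add (hC n) (hC' n))
  rw [ω.lim_eq hC, ω.lim_eq hC', ω.lim_eq h, ← map_add]
  congr 1

theorem DixmierLimit.lim_const_mul {s : ℕ → ℝ} (c : ℝ) (hs : ∃ C : ℝ, ∀ n, ‖s n‖ ≤ C) :
    ω.lim (fun n => c * s n) = c * ω.lim s := by
  obtain ⟨C, hC⟩ := hs
  have h : ∀ n, ‖c * s n‖ ≤ ‖c‖ * C := fun n => by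
    rw [norm_mul]
    exact mul_le_mul_of_nonneg_left (hC n) (norm_nonneg c)
  rw [ω.lim_eq hC, ω.lim_eq h, ← smul_eq_mul c (ω.toLinearMap _), ← map_smul]
  congr 1

theorem DixmierLimit.lim_nonneg {s : ℕ → ℝ} (h : ∀ n, 0 ≤ s n) : 0 ≤ ω.lim s := by
  by_cases hs : ∃ C : ℝ, ∀ n, ‖s n‖ ≤ C
  · obtain ⟨C, hC⟩ := hs
    rw [ω.lim_eq hC]
    exact ω.nonneg _ h
  · rw [DixmierLimit.lim, dif_neg hs]

theorem DixmierLimit.lim_mono {s t : ℕ → ℝ} (hs : ∃ C : ℝ, ∀ n, ‖s n‖ ≤ C)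
    (ht : ∃ C : ℝ, ∀ n, ‖t n‖ ≤ C) (h : ∀ n, s n ≤ t n) : ω.lim s ≤ ω.lim t := by
  have hs' : ∃ C : ℝ, ∀ n, ‖-1 * s n‖ ≤ C := by simpa using hs
  have h1 : 0 ≤ ω.lim (fun n => t n + -1 * s n) := ω.lim_nonneg fun n => by linarith [h n]
  rw [ω.lim_add ht hs', ω.lim_const_mul _ hs] at h1
  linarith

theorem exists_norm_le_of_tendsto {s : ℕ → ℝ} {l : ℝ}
    (h : Filter.Tendsto s Filter.atTop (nhds l)) : ∃ C : ℝ, ∀ n, ‖s n‖ ≤ C := by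
  obtain ⟨C, hC⟩ := (Metric.isBounded_range_of_tendsto s h).exists_norm_le
  exact ⟨C, fun n => hC _ ⟨n, rfl⟩⟩

theorem DixmierLimit.lim_of_tendsto {s : ℕ → ℝ} {l : ℝ}
    (h : Filter.Tendsto s Filter.atTop (nhds l)) : ω.lim s = l := by
  obtain ⟨C, hC⟩ := exists_norm_le_of_tendsto h
  rw [ω.lim_eq hC]
  exact ω.eq_of_tendsto _ l h

theorem DixmierLimit.lim_le_of_le_add {s t e : ℕ → ℝ} (hs : ∃ C : ℝ, ∀ n, ‖s n‖ ≤ C)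
    (ht : ∃ C : ℝ, ∀ n, ‖t n‖ ≤ C) (he : Filter.Tendsto e Filter.atTop (nhds 0))
    (h : ∀ n, s n ≤ t n + e n) : ω.lim s ≤ ω.lim t := by
  have he' := exists_norm_le_of_tendsto he
  have hte : ∃ C : ℝ, ∀ n, ‖t n + e n‖ ≤ C := by
    obtain ⟨C, hC⟩ := ht
    obtain ⟨C', hC'⟩ := he'
    exact ⟨C + C', fun n => (norm_add_le _ _).trans (add_le_add (hC n) (hC' n))⟩
  have h1 := ω.lim_mono hs hte h
  rw [ω.lim_add ht he', ω.lim_of_tendsto he] at h1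
  linarith

theorem DixmierLimit.lim_half {s : ℕ → ℝ} (hs : ∃ C : ℝ, ∀ n, ‖s n‖ ≤ C) :
    ω.lim (fun n => s (n / 2)) = ω.lim s := by
  obtain ⟨C, hC⟩ := hs
  rw [ω.lim_eq hC, ω.lim_eq fun n => hC (n / 2),
    ← ω.scale_invariant (BoundedContinuousFunction.ofNormedAddCommGroupDiscrete s C hC)]
  congr 1

end GeneralizedLimit

/-! ### The Dixmier trace on the weak trace class -/

section DixmierTrace

variable {H : Type*} [NormedAddCommGroup H] [InnerProductSpace ℂ H]

theorem sum_singularNumber_nonneg (T : H →L[ℂ] H) (N : ℕ) :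
    0 ≤ ∑ k ∈ Finset.range N, singularNumber T k :=
  Finset.sum_nonneg fun _ _ => singularNumber_nonneg _ _

theorem sum_singularNumber_div_log_le {T : H →L[ℂ] H} {C : ℝ}
    (hT : ∀ k : ℕ, singularNumber T k ≤ C * ((k : ℝ) + 1) ^ (-(1 : ℝ))) (N : ℕ) :
    (∑ k ∈ Finset.range N, singularNumber T k) / Real.log N ≤ 3 * C := by
  have hC : 0 ≤ C := by simpa using (singularNumber_nonneg T 0).trans (hT 0)
  rcases Nat.lt_or_ge N 2 with hN | hN
  · have : Real.log N = 0 := by interval_cases N <;> simp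
    rw [this, div_zero]
    positivity
  -- For `N ≥ 2`, `1 + log N ≤ 3 log N` because `log N ≥ log 2 > 1 / 2`.
  have hlog2 : (1 : ℝ) / 2 < Real.log 2 := by linarith [Real.log_two_gt_d9]
  have hlog : Real.log 2 ≤ Real.log N :=
    Real.log_le_log (by norm_num) (by exact_mod_cast hN)
  rw [div_le_iff₀ (by linarith)]
  have h1 : ∑ k ∈ Finset.range N, singularNumber T k ≤ C * (harmonic N : ℝ) := by
    rw [harmonic]
    push_cast
    rw [Finset.mul_sum]
    refine Finset.sum_le_sum fun k _ => ?_
    have := hT k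
    rwa [Real.rpow_neg_one] at this
  have h2 := harmonic_le_one_add_log N
  nlinarith

theorem exists_norm_sum_singularNumber_div_log_le {T : H →L[ℂ] H} {C : ℝ}
    (hT : ∀ k : ℕ, singularNumber T k ≤ C * ((k : ℝ) + 1) ^ (-(1 : ℝ))) :
    ∃ C' : ℝ, ∀ N : ℕ, ‖(∑ k ∈ Finset.range N, singularNumber T k) / Real.log N‖ ≤ C' := by
  refine ⟨3 * C, fun N => ?_⟩
  rw [Real.norm_of_nonneg (div_nonneg (sum_singularNumber_nonneg T N) (Real.log_natCast_nonneg N))]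
  exact sum_singularNumber_div_log_le hT N

variable (ω : DixmierLimit)

theorem dixmierTracePos_nonneg (T : H →L[ℂ] H) : 0 ≤ dixmierTracePos ω T :=
  ω.lim_nonneg fun N => div_nonneg (sum_singularNumber_nonneg T N) (Real.log_natCast_nonneg N)

theorem dixmierTracePos_le {T : H →L[ℂ] H} {C : ℝ}
    (hT : ∀ k : ℕ, singularNumber T k ≤ C * ((k : ℝ) + 1) ^ (-(1 : ℝ))) :
    dixmierTracePos ω T ≤ 3 * C := by
  have h : ω.lim (fun _ => 3 * C) = 3 * C := ω.lim_of_tendsto tendsto_const_nhds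
  rw [← h]
  exact ω.lim_mono (exists_norm_sum_singularNumber_div_log_le hT) ⟨_, fun _ => le_rfl⟩
    (sum_singularNumber_div_log_le hT)

theorem dixmierTracePos_congr {S T : H →L[ℂ] H}
    (h : ∀ k, singularNumber S k = singularNumber T k) :
    dixmierTracePos ω S = dixmierTracePos ω T := by
  simp only [dixmierTracePos, h]

variable [CompleteSpace H]

theorem exists_norm_avg_le {T : H →L[ℂ] H} (hT : T ∈ weakSchatten H 1) :
    ∃ C' : ℝ, ∀ N : ℕ, ‖(∑ k ∈ Finset.range N, singularNumber T k) / Real.log N‖ ≤ C' := by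
  obtain ⟨C, hC⟩ := hT
  exact exists_norm_sum_singularNumber_div_log_le hC

theorem dixmierTracePos_smul {T : H →L[ℂ] H} (hT : T ∈ weakSchatten H 1) {r : ℝ} (hr : 0 ≤ r) :
    dixmierTracePos ω (r • T) = r * dixmierTracePos ω T := by
  rw [dixmierTracePos, dixmierTracePos, ← ω.lim_const_mul r (exists_norm_avg_le hT)]
  congr 1
  funext N
  rw [← mul_div_assoc, Finset.mul_sum]
  congr 1
  refine Finset.sum_congr rfl fun k _ => ?_
  have h : r • T = (r : ℂ) • T := rfl
  rw [h, singularNumber_smul, Complex.norm_real, Real.norm_of_nonneg hr]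

/-- Operators whose singular numbers are `O(k^{-p})` with `p > 1` are of trace class, so their
Dixmier trace vanishes. -/
theorem dixmierTracePos_eq_zero {T : H →L[ℂ] H} {p : ℝ} (hp : 1 < p)
    (hT : T ∈ weakSchatten H p) : dixmierTracePos ω T = 0 := by
  obtain ⟨C, hC⟩ := hT
  have hsum : Summable fun k : ℕ => ((k : ℝ) + 1) ^ (-p) := by
    have h := (summable_nat_add_iff 1).2 (Real.summable_nat_rpow.2 (by linarith : -p < -1))
    simpa using h
  have hbound : ∀ N : ℕ, ∑ k ∈ Finset.range N, singularNumber T k ≤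
      ∑' k : ℕ, C * ((k : ℝ) + 1) ^ (-p) := fun N =>
    (Finset.sum_le_sum fun k _ => hC k).trans
      ((hsum.mul_left C).sum_le_tsum _ fun k _ => (singularNumber_nonneg T k).trans (hC k))
  refine ω.lim_of_tendsto ?_
  have hlog : Filter.Tendsto (fun N : ℕ => Real.log N) Filter.atTop Filter.atTop :=
    Real.tendsto_log_atTop.comp tendsto_natCast_atTop_atTop
  refine squeeze_zero
    (fun N => div_nonneg (sum_singularNumber_nonneg T N) (Real.log_natCast_nonneg N))
    (fun N => div_le_div_of_nonneg_right (hbound N) (Real.log_natCast_nonneg N))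
    (hlog.const_div_atTop _)

/-- Replacing `log N` by `log ⌊N / 2⌋` changes the logarithmic averages by a null sequence. -/
theorem tendsto_avg_half_sub_avg {T : H →L[ℂ] H} (hT : T ∈ weakSchatten H 1) :
    Filter.Tendsto (fun N : ℕ =>
      (∑ k ∈ Finset.range N, singularNumber T k) / Real.log ((N / 2 : ℕ) : ℝ) -
      (∑ k ∈ Finset.range N, singularNumber T k) / Real.log N) Filter.atTop (nhds 0) := by
  obtain ⟨C, hC⟩ := exists_norm_avg_le hT
  have hC0 : 0 ≤ C := (norm_nonneg _).trans (hC 0)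
  have hhalf : Filter.Tendsto (fun N : ℕ => Real.log ((N / 2 : ℕ) : ℝ)) Filter.atTop
      Filter.atTop :=
    Real.tendsto_log_atTop.comp (tendsto_natCast_atTop_atTop.comp
      (Nat.tendsto_div_const_atTop (by norm_num)))
  refine squeeze_zero_norm' ?_ ((hhalf.const_div_atTop (C * Real.log 4)))
  filter_upwards [Filter.eventually_ge_atTop 4] with N hN
  have h2 : 2 ≤ N / 2 := by omega
  have hpos : 0 < Real.log ((N / 2 : ℕ) : ℝ) := Real.log_pos (by exact_mod_cast h2)
  have hposN : 0 < Real.log (N : ℝ) := Real.log_pos (by exact_mod_cast (by omega : 1 < N))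
  have hle : Real.log ((N / 2 : ℕ) : ℝ) ≤ Real.log N :=
    Real.log_le_log (by exact_mod_cast (by omega : 0 < N / 2))
      (by exact_mod_cast Nat.div_le_self N 2)
  have hle4 : Real.log N ≤ Real.log ((N / 2 : ℕ) : ℝ) + Real.log 4 := by
    rw [← Real.log_mul (by exact_mod_cast (by omega : N / 2 ≠ 0)) (by norm_num)]
    refine Real.log_le_log (by exact_mod_cast (by omega : 0 < N)) ?_
    exact_mod_cast (by omega : N ≤ N / 2 * 4)
  set σ := ∑ k ∈ Finset.range N, singularNumber T k
  have e : σ / Real.log ((N / 2 : ℕ) : ℝ) - σ / Real.log N =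
      (σ / Real.log N) * ((Real.log N - Real.log ((N / 2 : ℕ) : ℝ)) /
        Real.log ((N / 2 : ℕ) : ℝ)) := by
    field_simp
  rw [e, norm_mul, mul_div_assoc]
  refine mul_le_mul (hC N) ?_ (norm_nonneg _) hC0
  rw [Real.norm_of_nonneg (div_nonneg (by linarith) hpos.le)]
  exact div_le_div_of_nonneg_right (by linarith) hpos.le

/-- Additivity on positive operators. The Ky Fan inequalities
`σ_N(S + T) ≤ σ_N(S) + σ_N(T) ≤ σ_{2N}(S + T)` pinch the averages between two sequences that have
the same generalized limit, by invariance of `ω` under doubling. -/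
theorem dixmierTracePos_add {S T : H →L[ℂ] H} (hS0 : 0 ≤ S) (hT0 : 0 ≤ T)
    (hS : S ∈ weakSchatten H 1) (hT : T ∈ weakSchatten H 1) :
    dixmierTracePos ω (S + T) = dixmierTracePos ω S + dixmierTracePos ω T := by
  have hST := weakSchatten_add zero_le_one hS hT
  have bS := exists_norm_avg_le hS
  have bT := exists_norm_avg_le hT
  have bST := exists_norm_avg_le hST
  have bsum : ∃ C : ℝ, ∀ N : ℕ, ‖(∑ k ∈ Finset.range N, singularNumber S k) / Real.log N +
      (∑ k ∈ Finset.range N, singularNumber T k) / Real.log N‖ ≤ C := by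
    obtain ⟨C, hC⟩ := bS
    obtain ⟨C', hC'⟩ := bT
    exact ⟨C + C', fun n => (norm_add_le _ _).trans (add_le_add (hC n) (hC' n))⟩
  rw [dixmierTracePos, dixmierTracePos, dixmierTracePos, ← ω.lim_add bS bT]
  refine le_antisymm (ω.lim_mono bST bsum fun N => ?_) ?_
  · rw [← add_div]
    exact div_le_div_of_nonneg_right (sum_singularNumber_add_le hS0 hT0 N)
      (Real.log_natCast_nonneg N)
  · rw [← ω.lim_half bsum]
    refine ω.lim_le_of_le_add ?_ bST (tendsto_avg_half_sub_avg hST) fun N => ?_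
    · obtain ⟨C, hC⟩ := bsum
      exact ⟨C, fun N => hC (N / 2)⟩
    · rw [← add_div, add_sub_cancel]
      refine div_le_div_of_nonneg_right ?_ (Real.log_natCast_nonneg _)
      refine (sum_singularNumber_add_ge hS0 hT0 (N / 2)).trans ?_
      exact Finset.sum_le_sum_of_subset_of_nonneg (Finset.range_mono (by omega))
        fun _ _ _ => singularNumber_nonneg _ _

/-- The Dixmier trace of a self-adjoint operator, as the difference of the values at the positive
and negative parts. -/
noncomputable def selfAdjointDixmierTrace (T : H →L[ℂ] H) : ℝ :=
  dixmierTracePos ω T⁺ - dixmierTracePos ω T⁻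

theorem dixmierTrace_eq (T : H →L[ℂ] H) :
    dixmierTrace ω T = (selfAdjointDixmierTrace ω (realPart T : H →L[ℂ] H) : ℂ) +
      Complex.I * (selfAdjointDixmierTrace ω (imaginaryPart T : H →L[ℂ] H) : ℂ) := rfl

theorem selfAdjointDixmierTrace_sub {S T : H →L[ℂ] H} (hS0 : 0 ≤ S) (hT0 : 0 ≤ T)
    (hS : S ∈ weakSchatten H 1) (hT : T ∈ weakSchatten H 1) :
    selfAdjointDixmierTrace ω (S - T) = dixmierTracePos ω S - dixmierTracePos ω T := by
  have hsa : IsSelfAdjoint (S - T) := hS0.isSelfAdjoint.sub hT0.isSelfAdjoint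
  have hST := weakSchatten_sub zero_le_one hS hT
  have h : (S - T)⁺ + T = S + (S - T)⁻ := by
    have := CFC.posPart_sub_negPart (S - T) hsa
    rw [sub_eq_sub_iff_add_eq_add] at this
    exact this
  have h1 := dixmierTracePos_add ω (CFC.posPart_nonneg (S - T)) hT0
    (weakSchatten_posPart hsa hST) hT
  have h2 := dixmierTracePos_add ω hS0 (CFC.negPart_nonneg (S - T)) hS
    (weakSchatten_negPart hsa hST)
  rw [h, h2] at h1
  rw [selfAdjointDixmierTrace]
  linarith

theorem selfAdjointDixmierTrace_add {S T : H →L[ℂ] H} (hS0 : IsSelfAdjoint S)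
    (hT0 : IsSelfAdjoint T) (hS : S ∈ weakSchatten H 1) (hT : T ∈ weakSchatten H 1) :
    selfAdjointDixmierTrace ω (S + T) =
      selfAdjointDixmierTrace ω S + selfAdjointDixmierTrace ω T := by
  have e : S + T = (S⁺ + T⁺) - (S⁻ + T⁻) := by
    calc S + T = (S⁺ - S⁻) + (T⁺ - T⁻) := by
          rw [CFC.posPart_sub_negPart S hS0, CFC.posPart_sub_negPart T hT0]
      _ = _ := by abel
  have hSp := weakSchatten_posPart hS0 hS
  have hSn := weakSchatten_negPart hS0 hS
  have hTp := weakSchatten_posPart hT0 hT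
  have hTn := weakSchatten_negPart hT0 hT
  rw [e, selfAdjointDixmierTrace_sub ω
    (add_nonneg (CFC.posPart_nonneg S) (CFC.posPart_nonneg T))
    (add_nonneg (CFC.negPart_nonneg S) (CFC.negPart_nonneg T))
    (weakSchatten_add zero_le_one hSp hTp) (weakSchatten_add zero_le_one hSn hTn),
    dixmierTracePos_add ω (CFC.posPart_nonneg S) (CFC.posPart_nonneg T) hSp hTp,
    dixmierTracePos_add ω (CFC.negPart_nonneg S) (CFC.negPart_nonneg T) hSn hTn]
  rw [selfAdjointDixmierTrace, selfAdjointDixmierTrace]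
  ring

theorem weakSchatten_real_smul {p : ℝ} (r : ℝ) {T : H →L[ℂ] H}
    (hT : T ∈ weakSchatten H p) : r • T ∈ weakSchatten H p :=
  weakSchatten_smul (r : ℂ) hT

theorem selfAdjointDixmierTrace_neg (T : H →L[ℂ] H) :
    selfAdjointDixmierTrace ω (-T) = -selfAdjointDixmierTrace ω T := by
  rw [selfAdjointDixmierTrace, selfAdjointDixmierTrace, CFC.posPart_neg, CFC.negPart_neg]
  ring

theorem selfAdjointDixmierTrace_smul (r : ℝ) {T : H →L[ℂ] H} (hT0 : IsSelfAdjoint T)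
    (hT : T ∈ weakSchatten H 1) :
    selfAdjointDixmierTrace ω (r • T) = r * selfAdjointDixmierTrace ω T := by
  have hp := weakSchatten_posPart hT0 hT
  have hn := weakSchatten_negPart hT0 hT
  have key : ∀ r : ℝ, 0 ≤ r →
      selfAdjointDixmierTrace ω (r • T) = r * selfAdjointDixmierTrace ω T := fun r hr => by
    have e : r • T = r • T⁺ - r • T⁻ := by
      rw [← smul_sub, CFC.posPart_sub_negPart T hT0]
    rw [e, selfAdjointDixmierTrace_sub ω (smul_nonneg hr (CFC.posPart_nonneg T))
      (smul_nonneg hr (CFC.negPart_nonneg T)) (weakSchatten_real_smul r hp)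
      (weakSchatten_real_smul r hn), dixmierTracePos_smul ω hp hr, dixmierTracePos_smul ω hn hr,
      selfAdjointDixmierTrace]
    ring
  rcases le_total 0 r with hr | hr
  · exact key r hr
  · have h := key (-r) (by linarith)
    rw [neg_smul, selfAdjointDixmierTrace_neg] at h
    linarith

theorem abs_selfAdjointDixmierTrace_le {T : H →L[ℂ] H} (hT0 : IsSelfAdjoint T) {C : ℝ}
    (hT : ∀ k : ℕ, singularNumber T k ≤ C * ((k : ℝ) + 1) ^ (-(1 : ℝ))) :
    |selfAdjointDixmierTrace ω T| ≤ 3 * C := by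
  have h1 := dixmierTracePos_le ω fun k => (singularNumber_posPart_le hT0 k).trans (hT k)
  have h2 := dixmierTracePos_le ω fun k => (singularNumber_negPart_le hT0 k).trans (hT k)
  have h3 := dixmierTracePos_nonneg ω T⁺
  have h4 := dixmierTracePos_nonneg ω T⁻
  rw [selfAdjointDixmierTrace, abs_le]
  constructor <;> linarith

theorem singularNumber_realPart_le {T : H →L[ℂ] H} {p C : ℝ} (hp : 0 ≤ p)
    (hT : ∀ k : ℕ, singularNumber T k ≤ C * ((k : ℝ) + 1) ^ (-p)) (k : ℕ) :
    singularNumber (realPart T : H →L[ℂ] H) k ≤ C * 2 ^ p * ((k : ℝ) + 1) ^ (-p) := by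
  refine singularNumber_le_of_double hp (fun m => ?_) k
  have e : (realPart T : H →L[ℂ] H) = ((2⁻¹ : ℝ) : ℂ) • (T + star T) := realPart_apply_coe T
  rw [e, singularNumber_smul, Complex.norm_real]
  have h := singularNumber_add_le T (star T) m m
  rw [singularNumber_star] at h
  have := hT m
  norm_num
  linarith

theorem singularNumber_imaginaryPart_le {T : H →L[ℂ] H} {p C : ℝ} (hp : 0 ≤ p)
    (hT : ∀ k : ℕ, singularNumber T k ≤ C * ((k : ℝ) + 1) ^ (-p)) (k : ℕ) :
    singularNumber (imaginaryPart T : H →L[ℂ] H) k ≤ C * 2 ^ p * ((k : ℝ) + 1) ^ (-p) := by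
  have e : imaginaryPart T = realPart (-(Complex.I • T)) := by
    rw [map_neg, realPart_I_smul, neg_neg]
  rw [e]
  refine singularNumber_realPart_le hp (fun k => ?_) k
  rw [singularNumber_neg, singularNumber_smul, Complex.norm_I, one_mul]
  exact hT k

theorem weakSchatten_realPart {p : ℝ} (hp : 0 ≤ p) {T : H →L[ℂ] H} (hT : T ∈ weakSchatten H p) :
    (realPart T : H →L[ℂ] H) ∈ weakSchatten H p := by
  obtain ⟨C, hC⟩ := hT
  exact ⟨_, singularNumber_realPart_le hp hC⟩

theorem weakSchatten_imaginaryPart {p : ℝ} (hp : 0 ≤ p) {T : H →L[ℂ] H}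
    (hT : T ∈ weakSchatten H p) : (imaginaryPart T : H →L[ℂ] H) ∈ weakSchatten H p := by
  obtain ⟨C, hC⟩ := hT
  exact ⟨_, singularNumber_imaginaryPart_le hp hC⟩

theorem norm_dixmierTrace_le {T : H →L[ℂ] H} {C : ℝ}
    (hT : ∀ k : ℕ, singularNumber T k ≤ C * ((k : ℝ) + 1) ^ (-(1 : ℝ))) :
    ‖dixmierTrace ω T‖ ≤ 12 * C := by
  have h1 := abs_selfAdjointDixmierTrace_le ω (realPart T).2
    (singularNumber_realPart_le zero_le_one hT)
  have h2 := abs_selfAdjointDixmierTrace_le ω (imaginaryPart T).2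
    (singularNumber_imaginaryPart_le zero_le_one hT)
  rw [dixmierTrace_eq]
  refine (norm_add_le _ _).trans ?_
  rw [norm_mul, Complex.norm_I, one_mul, Complex.norm_real, Complex.norm_real]
  simp only [Real.rpow_one] at h1 h2
  simp only [Real.norm_eq_abs]
  linarith

theorem dixmierTrace_add {S T : H →L[ℂ] H} (hS : S ∈ weakSchatten H 1)
    (hT : T ∈ weakSchatten H 1) :
    dixmierTrace ω (S + T) = dixmierTrace ω S + dixmierTrace ω T := by
  simp only [dixmierTrace_eq, map_add, AddSubgroup.coe_add]
  rw [selfAdjointDixmierTrace_add ω (realPart S).2 (realPart T).2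
      (weakSchatten_realPart zero_le_one hS) (weakSchatten_realPart zero_le_one hT),
    selfAdjointDixmierTrace_add ω (imaginaryPart S).2 (imaginaryPart T).2
      (weakSchatten_imaginaryPart zero_le_one hS) (weakSchatten_imaginaryPart zero_le_one hT)]
  push_cast
  ring

theorem dixmierTrace_smul (c : ℂ) {T : H →L[ℂ] H} (hT : T ∈ weakSchatten H 1) :
    dixmierTrace ω (c • T) = c * dixmierTrace ω T := by
  have hR := weakSchatten_realPart zero_le_one hT
  have hI := weakSchatten_imaginaryPart zero_le_one hT
  have sR : ∀ r : ℝ, IsSelfAdjoint (r • (realPart T : H →L[ℂ] H)) := fun r =>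
    (IsSelfAdjoint.all r).smul (realPart T).2
  have sI : ∀ r : ℝ, IsSelfAdjoint (r • (imaginaryPart T : H →L[ℂ] H)) := fun r =>
    (IsSelfAdjoint.all r).smul (imaginaryPart T).2
  have e1 : ((realPart (c • T) : selfAdjoint (H →L[ℂ] H)) : H →L[ℂ] H) =
      c.re • (realPart T : H →L[ℂ] H) + (-c.im) • (imaginaryPart T : H →L[ℂ] H) := by
    rw [realPart_smul, neg_smul, ← sub_eq_add_neg]
    rfl
  have e2 : ((imaginaryPart (c • T) : selfAdjoint (H →L[ℂ] H)) : H →L[ℂ] H) =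
      c.re • (imaginaryPart T : H →L[ℂ] H) + c.im • (realPart T : H →L[ℂ] H) := by
    rw [imaginaryPart_smul]
    rfl
  rw [dixmierTrace_eq, e1, e2, selfAdjointDixmierTrace_add ω (sR _) (sI _)
      (weakSchatten_real_smul _ hR) (weakSchatten_real_smul _ hI),
    selfAdjointDixmierTrace_add ω (sI _) (sR _)
      (weakSchatten_real_smul _ hI) (weakSchatten_real_smul _ hR),
    selfAdjointDixmierTrace_smul ω _ (realPart T).2 hR,
    selfAdjointDixmierTrace_smul ω _ (realPart T).2 hR,
    selfAdjointDixmierTrace_smul ω _ (imaginaryPart T).2 hI,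
    selfAdjointDixmierTrace_smul ω _ (imaginaryPart T).2 hI, dixmierTrace_eq]
  set x := selfAdjointDixmierTrace ω (realPart T : H →L[ℂ] H)
  set y := selfAdjointDixmierTrace ω (imaginaryPart T : H →L[ℂ] H)
  refine Complex.ext ?_ ?_
  · simp
    ring
  · simp

theorem dixmierTrace_sub {S T : H →L[ℂ] H} (hS : S ∈ weakSchatten H 1)
    (hT : T ∈ weakSchatten H 1) :
    dixmierTrace ω (S - T) = dixmierTrace ω S - dixmierTrace ω T := by
  have h := dixmierTrace_smul ω (-1) hT
  rw [neg_one_smul] at h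
  rw [sub_eq_add_neg, dixmierTrace_add ω hS (weakSchatten_neg hT), h]
  ring

theorem dixmierTrace_eq_zero {T : H →L[ℂ] H} {p : ℝ} (hp : 1 < p) (hT : T ∈ weakSchatten H p) :
    dixmierTrace ω T = 0 := by
  have hp0 : 0 ≤ p := by linarith
  have hR := weakSchatten_realPart hp0 hT
  have hI := weakSchatten_imaginaryPart hp0 hT
  rw [dixmierTrace_eq, selfAdjointDixmierTrace, selfAdjointDixmierTrace,
    dixmierTracePos_eq_zero ω hp (weakSchatten_posPart (realPart T).2 hR),
    dixmierTracePos_eq_zero ω hp (weakSchatten_negPart (realPart T).2 hR),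
    dixmierTracePos_eq_zero ω hp (weakSchatten_posPart (imaginaryPart T).2 hI),
    dixmierTracePos_eq_zero ω hp (weakSchatten_negPart (imaginaryPart T).2 hI)]
  simp

theorem selfAdjointDixmierTrace_unitary_conj (U : unitary (H →L[ℂ] H)) {T : H →L[ℂ] H}
    (hT0 : IsSelfAdjoint T) (hT : T ∈ weakSchatten H 1) :
    selfAdjointDixmierTrace ω ((U : H →L[ℂ] H) * T * star (U : H →L[ℂ] H)) =
      selfAdjointDixmierTrace ω T := by
  have hp := weakSchatten_posPart hT0 hT
  have hn := weakSchatten_negPart hT0 hT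
  have e : (U : H →L[ℂ] H) * T * star (U : H →L[ℂ] H) =
      (U : H →L[ℂ] H) * T⁺ * star (U : H →L[ℂ] H) -
        (U : H →L[ℂ] H) * T⁻ * star (U : H →L[ℂ] H) := by
    rw [← sub_mul, ← mul_sub, CFC.posPart_sub_negPart T hT0]
  rw [e, selfAdjointDixmierTrace_sub ω
    (star_right_conjugate_nonneg (CFC.posPart_nonneg T) _)
    (star_right_conjugate_nonneg (CFC.negPart_nonneg T) _)
    (weakSchatten_mul_right zero_le_one (weakSchatten_mul_left zero_le_one _ hp) _)
    (weakSchatten_mul_right zero_le_one (weakSchatten_mul_left zero_le_one _ hn) _),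
    dixmierTracePos_congr ω (singularNumber_unitary_conj U T⁺),
    dixmierTracePos_congr ω (singularNumber_unitary_conj U T⁻)]
  rfl

theorem realPart_unitary_conj (U : unitary (H →L[ℂ] H)) (T : H →L[ℂ] H) :
    ((realPart ((U : H →L[ℂ] H) * T * star (U : H →L[ℂ] H)) : selfAdjoint (H →L[ℂ] H)) :
      H →L[ℂ] H) = (U : H →L[ℂ] H) * (realPart T : H →L[ℂ] H) * star (U : H →L[ℂ] H) := by
  rw [realPart_apply_coe, realPart_apply_coe, mul_smul_comm, smul_mul_assoc, mul_add, add_mul]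
  simp only [star_mul, star_star, mul_assoc]

theorem imaginaryPart_unitary_conj (U : unitary (H →L[ℂ] H)) (T : H →L[ℂ] H) :
    ((imaginaryPart ((U : H →L[ℂ] H) * T * star (U : H →L[ℂ] H)) : selfAdjoint (H →L[ℂ] H)) :
      H →L[ℂ] H) = (U : H →L[ℂ] H) * (imaginaryPart T : H →L[ℂ] H) * star (U : H →L[ℂ] H) := by
  have e : ∀ S : H →L[ℂ] H, imaginaryPart S = realPart (-(Complex.I • S)) := fun S => by
    rw [map_neg, realPart_I_smul, neg_neg]
  rw [e, e, ← realPart_unitary_conj]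
  congr 2
  simp only [mul_neg, neg_mul, mul_smul_comm, smul_mul_assoc]

/-- The trace property of the Dixmier trace: unitary invariance, together with the fact that the
unitaries span the bounded operators. -/
theorem dixmierTrace_mul_comm (B : H →L[ℂ] H) {T : H →L[ℂ] H} (hT : T ∈ weakSchatten H 1) :
    dixmierTrace ω (B * T) = dixmierTrace ω (T * B) := by
  have hB : B ∈ Submodule.span ℂ (unitary (H →L[ℂ] H) : Set (H →L[ℂ] H)) := by
    rw [CStarAlgebra.span_unitary]
    trivial
  have hl : ∀ A : H →L[ℂ] H, A * T ∈ weakSchatten H 1 := fun A =>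
    weakSchatten_mul_left zero_le_one A hT
  have hr : ∀ A : H →L[ℂ] H, T * A ∈ weakSchatten H 1 := fun A =>
    weakSchatten_mul_right zero_le_one hT A
  induction hB using Submodule.span_induction with
  | mem U hU =>
    have hTU := hr U
    have h : U * T = U * (T * U) * star U := by
      rw [mul_assoc, mul_assoc, Unitary.mul_star_self_of_mem hU, mul_one]
    rw [h, dixmierTrace_eq, dixmierTrace_eq ω (T * U),
      realPart_unitary_conj ⟨U, hU⟩ (T * U), imaginaryPart_unitary_conj ⟨U, hU⟩ (T * U),
      selfAdjointDixmierTrace_unitary_conj ω ⟨U, hU⟩ (realPart (T * U)).2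
        (weakSchatten_realPart zero_le_one hTU),
      selfAdjointDixmierTrace_unitary_conj ω ⟨U, hU⟩ (imaginaryPart (T * U)).2
        (weakSchatten_imaginaryPart zero_le_one hTU)]
  | zero => simp
  | add A B _ _ hA hB =>
    rw [add_mul, mul_add, dixmierTrace_add ω (hl A) (hl B), dixmierTrace_add ω (hr A) (hr B),
      hA, hB]
  | smul c A _ hA =>
    rw [smul_mul_assoc, mul_smul_comm, dixmierTrace_smul ω c (hl A), dixmierTrace_smul ω c (hr A),
      hA]

end DixmierTrace

/-! ### Self-adjoint operators with compact resolvent -/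

section Spectral

variable {H : Type*} [NormedAddCommGroup H] [InnerProductSpace ℂ H]

/-- `K` is the resolvent `(D + i)⁻¹`. -/
def IsResolvent (D : H →ₗ.[ℂ] H) (K : H →L[ℂ] H) : Prop :=
  (∀ y : H, ∃ h : K y ∈ D.domain, D ⟨K y, h⟩ + Complex.I • K y = y) ∧
    ∀ x : D.domain, K (D x + Complex.I • (x : H)) = x

theorem ofReal_add_I_ne_zero (l : ℝ) : (l : ℂ) + Complex.I ≠ 0 := fun h => by
  simpa using congrArg Complex.im h

theorem mem_eigenspace_iff_resolvent {D : H →ₗ.[ℂ] H} {K : H →L[ℂ] H} (hK : IsResolvent D K)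
    (l : ℝ) (x : H) : x ∈ eigenspace D l ↔ ((l : ℂ) + Complex.I) • K x = x := by
  constructor
  · rintro ⟨h, hx⟩
    have := hK.2 ⟨x, h⟩
    rwa [hx, ← add_smul, map_smul] at this
  · intro h
    obtain ⟨h1, h2⟩ := hK.1 (((l : ℂ) + Complex.I) • x)
    have e : K (((l : ℂ) + Complex.I) • x) = x := by rw [map_smul, h]
    have h3 : x ∈ D.domain := e ▸ h1
    have e' : (⟨K (((l : ℂ) + Complex.I) • x), h1⟩ : D.domain) = ⟨x, h3⟩ := Subtype.ext e
    rw [e', e, add_smul] at h2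
    exact ⟨h3, add_right_cancel h2⟩

theorem isClosed_eigenspace {D : H →ₗ.[ℂ] H} {K : H →L[ℂ] H} (hK : IsResolvent D K) (l : ℝ) :
    IsClosed (eigenspace D l : Set H) := by
  have : (eigenspace D l : Set H) = {x | ((l : ℂ) + Complex.I) • K x = x} :=
    Set.ext fun x => mem_eigenspace_iff_resolvent hK l x
  rw [this]
  exact isClosed_eq (by fun_prop) continuous_id

theorem finiteDimensional_eigenspace [CompleteSpace H] {D : H →ₗ.[ℂ] H} {K : H →L[ℂ] H}
    (hK : IsResolvent D K) (hKc : IsCompactOperator K) (l : ℝ) :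
    FiniteDimensional ℂ (eigenspace D l) := by
  have hne := ofReal_add_I_ne_zero l
  have hfin := ContinuousLinearMap.finite_dimensional_eigenspace hKc
    ((l : ℂ) + Complex.I)⁻¹ (inv_ne_zero hne)
  refine Submodule.finiteDimensional_of_le
    (S₂ := Module.End.eigenspace K.toLinearMap ((l : ℂ) + Complex.I)⁻¹) fun x hx => ?_
  rw [Module.End.mem_eigenspace_iff, eq_inv_smul_iff₀ hne]
  exact (mem_eigenspace_iff_resolvent hK l x).1 hx

variable [CompleteSpace H] {D : H →ₗ.[ℂ] H}

theorem inner_apply_comm_of_isSelfAdjoint (hD : IsSelfAdjoint D) (x y : D.domain) :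
    inner ℂ (D x) (y : H) = inner ℂ (x : H) (D y) := by
  have h := LinearPMap.adjoint_isFormalAdjoint hD.dense_domain
  rw [LinearPMap.isSelfAdjoint_def.1 hD] at h
  exact h x y

theorem exists_apply_eq_of_forall_inner (hD : IsSelfAdjoint D) {y w : H}
    (h : ∀ x : D.domain, inner ℂ w (x : H) = inner ℂ y (D x)) :
    ∃ hy : y ∈ D.domain, D ⟨y, hy⟩ = w := by
  have key : ∃ hy : y ∈ D.adjoint.domain, D.adjoint ⟨y, hy⟩ = w :=
    ⟨LinearPMap.mem_adjoint_domain_of_exists y ⟨w, h⟩,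
      LinearPMap.adjoint_apply_eq hD.dense_domain _ h⟩
  rwa [LinearPMap.isSelfAdjoint_def.1 hD] at key

theorem star_resolvent_apply (hD : IsSelfAdjoint D) {K : H →L[ℂ] H} (hK : IsResolvent D K)
    (y : H) : ∃ h : star K y ∈ D.domain, D ⟨star K y, h⟩ = y + Complex.I • star K y := by
  refine exists_apply_eq_of_forall_inner hD fun x => ?_
  have h1 : inner ℂ (star K y) (D x + Complex.I • (x : H)) = inner ℂ y (x : H) := by
    rw [ContinuousLinearMap.star_eq_adjoint, ContinuousLinearMap.adjoint_inner_left, hK.2 x]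
  rw [inner_add_right, inner_smul_right] at h1
  rw [inner_add_left, inner_smul_left, Complex.conj_I, ← h1]
  ring

theorem resolvent_commute_star (hD : IsSelfAdjoint D) {K : H →L[ℂ] H} (hK : IsResolvent D K) :
    K * star K = star K * K := by
  have h1 : star K = K + (2 * Complex.I) • (K * star K) := by
    ext y
    obtain ⟨h, e⟩ := star_resolvent_apply hD hK y
    have h2 := hK.2 ⟨_, h⟩
    rw [e, add_assoc, ← add_smul, ← two_mul, map_add, map_smul] at h2
    exact h2.symm
  have h2 : star K = K + (2 * Complex.I) • (star K * K) := by
    ext y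
    obtain ⟨h, e⟩ := hK.1 y
    -- `K*` is a left inverse of `D - i`
    have h3 : star K (D ⟨K y, h⟩ - Complex.I • K y) = K y := by
      refine ext_inner_right ℂ fun u => ?_
      obtain ⟨hu, eu⟩ := hK.1 u
      rw [ContinuousLinearMap.star_eq_adjoint, ContinuousLinearMap.adjoint_inner_left,
        inner_sub_left, inner_smul_left, Complex.conj_I]
      have := inner_apply_comm_of_isSelfAdjoint hD ⟨K y, h⟩ ⟨K u, hu⟩
      rw [this]
      conv_rhs => rw [← eu, inner_add_right, inner_smul_right]
      ring
    have h4 : D ⟨K y, h⟩ - Complex.I • K y = y - (2 * Complex.I) • K y := by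
      rw [eq_sub_iff_add_eq, two_mul, add_smul, ← add_assoc, sub_add_cancel]
      exact e
    rw [h4, map_sub, map_smul, sub_eq_iff_eq_add] at h3
    exact h3
  have h3 := h1.symm.trans h2
  exact smul_right_injective _ (by simp) (add_left_cancel h3)

/-- The eigenspaces of a self-adjoint operator with compact resolvent span a dense subspace. The
resolvent `K` is normal, so `K* K` is compact, self-adjoint and injective; on each of its
(finite-dimensional) eigenspaces `D` acts as a symmetric operator. -/
theorem orthogonal_iSup_eigenspace (hD : IsSelfAdjoint D) {K : H →L[ℂ] H} (hK : IsResolvent D K)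
    (hKc : IsCompactOperator K) : (⨆ l : ℝ, eigenspace D l)ᗮ = ⊥ := by
  set A : H →L[ℂ] H := star K * K with hA
  have hAc : IsCompactOperator A := hKc.clm_comp (star K)
  have hAs : A.IsSymmetric :=
    ContinuousLinearMap.isSelfAdjoint_iff_isSymmetric.1 (IsSelfAdjoint.star_mul_self K)
  have hAK : A * K = K * A := by
    rw [hA, ← mul_assoc, resolvent_commute_star hD hK]
  have hK0 : ∀ x, K x = 0 → x = 0 := fun x hx => by
    obtain ⟨h, e⟩ := hK.1 x
    have h0 : (⟨K x, h⟩ : D.domain) = 0 := Subtype.ext hx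
    rw [h0, LinearPMap.map_zero, hx, smul_zero, add_zero] at e
    exact e.symm
  have hle : (⨆ μ, Module.End.eigenspace (A : Module.End ℂ H) μ) ≤ ⨆ l : ℝ, eigenspace D l := by
    refine iSup_le fun μ => ?_
    rcases eq_or_ne μ 0 with rfl | hμ
    · intro x hx
      have hx' : A x = 0 := by simpa using Module.End.mem_eigenspace_iff.1 hx
      have h1 : ‖K x‖ ^ 2 = 0 := by
        rw [norm_sq_eq_re_inner (𝕜 := ℂ), ← ContinuousLinearMap.adjoint_inner_right]
        change RCLike.re (inner ℂ x (A x)) = 0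
        rw [hx']
        simp
      rw [hK0 x (by simpa using h1)]
      exact Submodule.zero_mem _
    set W := Module.End.eigenspace (A : Module.End ℂ H) μ with hW
    have hWfin : FiniteDimensional ℂ W :=
      ContinuousLinearMap.finite_dimensional_eigenspace hAc μ hμ
    set B : H →L[ℂ] H := μ⁻¹ • K + Complex.I • 1 with hB
    have hAB : A * B = B * A := by
      rw [hB, mul_add, add_mul, mul_smul_comm, smul_mul_assoc, hAK, mul_smul_comm,
        smul_mul_assoc, mul_one, one_mul]
    have hmem : ∀ x ∈ W, A x = μ • x := fun x hx => Module.End.mem_eigenspace_iff.1 hx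
    have hBW : ∀ x ∈ W, (B : H →ₗ[ℂ] H) x ∈ W := fun x hx => by
      rw [hW, Module.End.mem_eigenspace_iff]
      change (A * B) x = μ • B x
      rw [hAB]
      change B (A x) = _
      rw [hmem x hx, map_smul]
    have hDB : ∀ x ∈ W, ∃ h : x ∈ D.domain, D ⟨x, h⟩ = B x := fun x hx => by
      obtain ⟨h, e⟩ := star_resolvent_apply hD hK (μ⁻¹ • K x)
      have e1 : star K (μ⁻¹ • K x) = x := by
        rw [map_smul]
        change μ⁻¹ • A x = x
        rw [hmem x hx, inv_smul_smul₀ hμ]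
      have h' : x ∈ D.domain := e1 ▸ h
      have e2 : (⟨star K (μ⁻¹ • K x), h⟩ : D.domain) = ⟨x, h'⟩ := Subtype.ext e1
      rw [e2, e1] at e
      exact ⟨h', e⟩
    set S : W →ₗ[ℂ] W := (B : H →ₗ[ℂ] H).restrict hBW with hS
    have hSsym : S.IsSymmetric := fun x y => by
      obtain ⟨hx, ex⟩ := hDB x x.2
      obtain ⟨hy, ey⟩ := hDB y y.2
      change inner ℂ (B x) (y : H) = inner ℂ (x : H) (B y)
      rw [← ex, ← ey]
      exact inner_apply_comm_of_isSelfAdjoint hD ⟨x, hx⟩ ⟨y, hy⟩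
    have htop : (⨆ ν, Module.End.eigenspace S ν) = ⊤ :=
      (Submodule.orthogonal_eq_bot_iff).1 hSsym.orthogonalComplement_iSup_eigenspaces_eq_bot
    have hmap : W = ⨆ ν, (Module.End.eigenspace S ν).map W.subtype := by
      rw [← Submodule.map_iSup, htop, Submodule.map_subtype_top]
    rw [hmap]
    refine iSup_le fun ν => ?_
    rintro _ ⟨v, hv, rfl⟩
    rcases eq_or_ne v 0 with rfl | hv0
    · simp
    have hev : Module.End.HasEigenvalue S ν :=
      Module.End.hasEigenvalue_of_hasEigenvector ⟨hv, hv0⟩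
    have hreal : ((ν.re : ℝ) : ℂ) = ν :=
      Complex.conj_eq_iff_re.1 (hSsym.conj_eigenvalue_eq_self hev)
    refine Submodule.mem_iSup_of_mem ν.re ?_
    obtain ⟨h, e⟩ := hDB v v.2
    refine ⟨h, ?_⟩
    rw [hreal]
    refine e.trans ?_
    exact congrArg (Subtype.val : W → H) (Module.End.mem_eigenspace_iff.1 hv)
  rw [eq_bot_iff, ← ContinuousLinearMap.orthogonalComplement_iSup_eigenspaces_eq_bot hAc hAs]
  exact Submodule.orthogonal_le hle

theorem eigenspace_isOrtho (hD : IsSelfAdjoint D) {l m : ℝ} (hlm : l ≠ m) :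
    eigenspace D l ⟂ eigenspace D m := by
  rw [Submodule.isOrtho_iff_inner_eq]
  rintro x ⟨hx, ex⟩ y ⟨hy, ey⟩
  have h := inner_apply_comm_of_isSelfAdjoint hD ⟨x, hx⟩ ⟨y, hy⟩
  rw [ex, ey] at h
  change inner ℂ ((l : ℂ) • x) y = inner ℂ x ((m : ℂ) • y) at h
  rw [inner_smul_left, inner_smul_right, Complex.conj_ofReal, ← sub_eq_zero, ← sub_mul] at h
  exact (mul_eq_zero.1 h).resolve_left (sub_ne_zero.2 (by exact_mod_cast hlm))

theorem eigenProj_mem {K : H →L[ℂ] H} (hK : IsResolvent D K) (l : ℝ) (x : H) :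
    eigenProj D l x ∈ eigenspace D l := by
  have h : eigenProj D l x ∈ (eigenspace D l).topologicalClosure :=
    Submodule.starProjection_apply_mem _ x
  rwa [(isClosed_eigenspace hK l).submodule_topologicalClosure_eq] at h

theorem eigenProj_eq_self {x : H} {l : ℝ} (hx : x ∈ eigenspace D l) : eigenProj D l x = x :=
  Submodule.starProjection_eq_self_iff.2 (Submodule.le_topologicalClosure _ hx)

theorem eigenProj_eq_zero (hD : IsSelfAdjoint D) {x : H} {l m : ℝ} (hlm : l ≠ m)
    (hx : x ∈ eigenspace D m) : eigenProj D l x = 0 := by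
  refine (Submodule.starProjection_apply_eq_zero_iff _).2 ?_
  rw [Submodule.orthogonal_closure]
  exact (eigenspace_isOrtho hD hlm.symm) hx

theorem inner_eigenProj {x v : H} {l : ℝ} (hv : v ∈ eigenspace D l) :
    inner ℂ v (eigenProj D l x) = inner ℂ v x := by
  have h := Submodule.inner_starProjection_left_eq_right (eigenspace D l).topologicalClosure v x
  have h2 := eigenProj_eq_self hv
  rw [eigenProj] at h2
  rw [eigenProj, ← h, h2]

theorem orthogonalFamily_eigenspace (hD : IsSelfAdjoint D) :
    OrthogonalFamily ℂ (fun l : ℝ => eigenspace D l) fun l => (eigenspace D l).subtypeₗᵢ :=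
  fun _ _ hlm v w => (Submodule.isOrtho_iff_inner_eq.1 (eigenspace_isOrtho hD hlm)) v v.2 w w.2

theorem norm_sq_sum_smul_eigenProj (hD : IsSelfAdjoint D) {K : H →L[ℂ] H} (hK : IsResolvent D K)
    (s : Finset ℝ) (c : ℝ → ℂ) (x : H) :
    ‖∑ l ∈ s, c l • eigenProj D l x‖ ^ 2 = ∑ l ∈ s, ‖c l • eigenProj D l x‖ ^ 2 :=
  (orthogonalFamily_eigenspace hD).norm_sum
    (fun l => ⟨c l • eigenProj D l x, Submodule.smul_mem _ _ (eigenProj_mem hK l x)⟩) s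

/-- Bessel's inequality for the spectral projections. -/
theorem sum_norm_sq_eigenProj_le (hD : IsSelfAdjoint D) {K : H →L[ℂ] H} (hK : IsResolvent D K)
    (s : Finset ℝ) (x : H) : ∑ l ∈ s, ‖eigenProj D l x‖ ^ 2 ≤ ‖x‖ ^ 2 := by
  set y := ∑ l ∈ s, eigenProj D l x with hy
  have h1 : ‖y‖ ^ 2 = ∑ l ∈ s, ‖eigenProj D l x‖ ^ 2 := by
    simpa using norm_sq_sum_smul_eigenProj hD hK s (fun _ => 1) x
  have h2 : inner ℂ y x = ((‖y‖ ^ 2 : ℝ) : ℂ) := by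
    rw [h1, hy, sum_inner]
    push_cast
    refine Finset.sum_congr rfl fun l _ => ?_
    rw [← inner_eigenProj (eigenProj_mem hK l x)]
    exact inner_self_eq_norm_sq_to_K _
  have h3 : ‖y‖ ^ 2 ≤ ‖y‖ * ‖x‖ := by
    have h := norm_inner_le_norm (𝕜 := ℂ) y x
    rwa [h2, Complex.norm_real, Real.norm_of_nonneg (by positivity)] at h
  have h4 : ‖y‖ ≤ ‖x‖ := by
    rcases (norm_nonneg y).eq_or_lt with h | h
    · rw [← h]
      exact norm_nonneg x
    · rw [pow_two] at h3
      exact le_of_mul_le_mul_left h3 h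
  rw [← h1]
  gcongr

theorem hasSum_eigenProj (hD : IsSelfAdjoint D) {K : H →L[ℂ] H} (hK : IsResolvent D K)
    (hKc : IsCompactOperator K) (x : H) : HasSum (fun l : ℝ => eigenProj D l x) x := by
  have hsum : Summable fun l : ℝ => eigenProj D l x := by
    refine ((orthogonalFamily_eigenspace hD).summable_iff_norm_sq_summable
      (fun l => ⟨eigenProj D l x, eigenProj_mem hK l x⟩)).2 ?_
    exact summable_of_sum_le (fun _ => by positivity)
      (fun s => sum_norm_sq_eigenProj_le hD hK s x)
  suffices h : x - ∑' l : ℝ, eigenProj D l x = 0 by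
    rw [sub_eq_zero] at h
    conv => arg 2; rw [h]
    exact hsum.hasSum
  rw [← Submodule.mem_bot ℂ, ← orthogonal_iSup_eigenspace hD hK hKc,
    Submodule.mem_orthogonal]
  intro v hv
  induction hv using Submodule.iSup_induction' with
  | mem m v hv =>
    have h1 : HasSum (fun l : ℝ => inner ℂ v (eigenProj D l x))
        (inner ℂ v (∑' l : ℝ, eigenProj D l x)) := hsum.hasSum.mapL (innerSL ℂ v)
    have h2 : HasSum (fun l : ℝ => inner ℂ v (eigenProj D l x))
        (inner ℂ v (eigenProj D m x)) := by
      refine hasSum_single m fun l hl => ?_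
      exact (Submodule.isOrtho_iff_inner_eq.1 (eigenspace_isOrtho hD hl.symm)) v hv _
        (eigenProj_mem hK l x)
    rw [inner_sub_right, h1.unique h2, inner_eigenProj hv, sub_self]
  | zero => simp
  | add v w _ _ hv hw => rw [inner_add_left, hv, hw, add_zero]

/-- The eigenvalues of `D` do not accumulate: otherwise `K` would map an orthonormal sequence of
eigenvectors to a uniformly separated one. -/
theorem finite_eigenvalues (hD : IsSelfAdjoint D) {K : H →L[ℂ] H} (hK : IsResolvent D K)
    (hKc : IsCompactOperator K) (r : ℝ) :
    {l : ℝ | |l| ≤ r ∧ eigenspace D l ≠ ⊥}.Finite := by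
  by_contra hinf
  let φ := Set.Infinite.natEmbedding _ hinf
  have hv : ∀ n, ∃ v ∈ eigenspace D (φ n), ‖v‖ = 1 := fun n => by
    obtain ⟨v, hv, hv0⟩ := Submodule.exists_mem_ne_zero_of_ne_bot (φ n).2.2
    refine ⟨((‖v‖⁻¹ : ℝ) : ℂ) • v, Submodule.smul_mem _ _ hv, ?_⟩
    rw [norm_smul, Complex.norm_real, norm_inv, norm_norm, inv_mul_cancel₀ (norm_ne_zero_iff.2 hv0)]
  choose v hvmem hvnorm using hv
  have hKv : ∀ n, (((φ n : ℝ) : ℂ) + Complex.I) • K (v n) = v n := fun n =>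
    (mem_eigenspace_iff_resolvent hK _ _).1 (hvmem n)
  have hr : 0 ≤ r := (abs_nonneg _).trans (φ 0).2.1
  have hlow : ∀ n, 1 ≤ (r + 1) * ‖K (v n)‖ := fun n => by
    have h := congrArg norm (hKv n)
    rw [norm_smul, hvnorm] at h
    refine h.symm.le.trans (mul_le_mul_of_nonneg_right ?_ (norm_nonneg _))
    refine (norm_add_le _ _).trans ?_
    rw [Complex.norm_I, Complex.norm_real, Real.norm_eq_abs]
    exact add_le_add_left (φ n).2.1 1
  have hmemK : ∀ n, K (v n) ∈ eigenspace D (φ n) := fun n => by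
    have h : K (v n) = (((φ n : ℝ) : ℂ) + Complex.I)⁻¹ • v n :=
      (eq_inv_smul_iff₀ (ofReal_add_I_ne_zero _)).2 (hKv n)
    rw [h]
    exact Submodule.smul_mem _ _ (hvmem n)
  have hsep : ∀ m n, m ≠ n → ‖K (v m)‖ ≤ dist (K (v m)) (K (v n)) := fun m n hmn => by
    have hne : (φ m : ℝ) ≠ φ n := fun h => hmn (φ.injective (Subtype.ext h))
    have hin : inner ℂ (K (v m)) (K (v n)) = 0 :=
      (Submodule.isOrtho_iff_inner_eq.1 (eigenspace_isOrtho hD hne)) _ (hmemK m) _ (hmemK n)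
    rw [dist_eq_norm]
    have h := norm_sub_sq (𝕜 := ℂ) (K (v m)) (K (v n))
    rw [hin, map_zero, mul_zero, sub_zero] at h
    refine le_of_sq_le_sq ?_ (norm_nonneg _)
    rw [h]
    exact le_add_of_nonneg_right (by positivity)
  have hcpt := hKc.isCompact_closure_image_closedBall (𝕜₁ := ℂ) 1
  obtain ⟨a, -, ψ, hψ, hlim⟩ := hcpt.tendsto_subseq (x := fun n => K (v n)) fun n =>
    subset_closure ⟨v n, by simp [hvnorm n], rfl⟩
  obtain ⟨N, hN⟩ := Metric.cauchySeq_iff.1 hlim.cauchySeq (1 / (r + 1)) (by positivity)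
  have h1 := hN N le_rfl (N + 1) (Nat.le_succ N)
  have h2 := hsep (ψ N) (ψ (N + 1)) (hψ (Nat.lt_succ_self N)).ne
  have h3 := hlow (ψ N)
  have h4 : ‖K (v (ψ N))‖ < 1 / (r + 1) := h2.trans_lt h1
  rw [lt_div_iff₀ (by positivity)] at h4
  linarith

theorem summable_absInv (hD : IsSelfAdjoint D) {K : H →L[ℂ] H} (hK : IsResolvent D K)
    (hKc : IsCompactOperator K) :
    Summable fun l : ℝ => ((|l|⁻¹ : ℝ) : ℂ) • eigenProj D l := by
  rw [summable_iff_vanishing_norm]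
  intro ε hε
  refine ⟨(finite_eigenvalues hD hK hKc (2 / ε)).toFinset, fun t ht => ?_⟩
  have hbound : ∀ l ∈ t, ∀ x, ‖((|l|⁻¹ : ℝ) : ℂ) • eigenProj D l x‖ ≤
      ε / 2 * ‖eigenProj D l x‖ := fun l hl x => by
    have hl' : l ∉ {l : ℝ | |l| ≤ 2 / ε ∧ eigenspace D l ≠ ⊥} := fun h =>
      Finset.disjoint_left.1 ht hl ((Set.Finite.mem_toFinset _).2 h)
    rw [Set.mem_ofPred_eq, not_and_or, not_le, not_not] at hl'
    rcases hl' with h | h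
    · rw [norm_smul, Complex.norm_real, Real.norm_of_nonneg (by positivity)]
      refine mul_le_mul_of_nonneg_right ?_ (norm_nonneg _)
      rw [inv_le_comm₀ (lt_trans (by positivity) h) (by positivity), inv_div]
      exact h.le
    · have h0 := eigenProj_mem hK l x
      rw [h, Submodule.mem_bot] at h0
      rw [h0]
      simp
  refine lt_of_le_of_lt ?_ (half_lt_self hε)
  refine ContinuousLinearMap.opNorm_le_bound _ (by positivity) fun x => ?_
  have e : (∑ l ∈ t, ((|l|⁻¹ : ℝ) : ℂ) • eigenProj D l) x =
      ∑ l ∈ t, ((|l|⁻¹ : ℝ) : ℂ) • eigenProj D l x := by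
    simp
  rw [e]
  refine le_of_sq_le_sq ?_ (by positivity)
  rw [norm_sq_sum_smul_eigenProj hD hK t (fun l => ((|l|⁻¹ : ℝ) : ℂ)), mul_pow]
  calc ∑ l ∈ t, ‖((|l|⁻¹ : ℝ) : ℂ) • eigenProj D l x‖ ^ 2
      ≤ ∑ l ∈ t, (ε / 2) ^ 2 * ‖eigenProj D l x‖ ^ 2 := by
        refine Finset.sum_le_sum fun l hl => ?_
        rw [← mul_pow]
        exact pow_le_pow_left₀ (norm_nonneg _) (hbound l hl x) 2
    _ ≤ (ε / 2) ^ 2 * ‖x‖ ^ 2 := by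
        rw [← Finset.mul_sum]
        exact mul_le_mul_of_nonneg_left (sum_norm_sq_eigenProj_le hD hK t x) (by positivity)

theorem hasSum_absInv (hD : IsSelfAdjoint D) {K : H →L[ℂ] H} (hK : IsResolvent D K)
    (hKc : IsCompactOperator K) (x : H) :
    HasSum (fun l : ℝ => ((|l|⁻¹ : ℝ) : ℂ) • eigenProj D l x) (absInv D x) :=
  (summable_absInv hD hK hKc).hasSum.mapL (ContinuousLinearMap.apply ℂ H x)

theorem eigenProj_absInv (hD : IsSelfAdjoint D) {K : H →L[ℂ] H} (hK : IsResolvent D K)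
    (hKc : IsCompactOperator K) (l : ℝ) (x : H) :
    eigenProj D l (absInv D x) = ((|l|⁻¹ : ℝ) : ℂ) • eigenProj D l x := by
  have h1 := (hasSum_absInv hD hK hKc x).mapL (eigenProj D l)
  refine h1.unique ?_
  have h2 : ((|l|⁻¹ : ℝ) : ℂ) • eigenProj D l x =
      eigenProj D l (((|l|⁻¹ : ℝ) : ℂ) • eigenProj D l x) :=
    (eigenProj_eq_self (Submodule.smul_mem _ _ (eigenProj_mem hK l x))).symm
  rw [h2]
  exact hasSum_single l fun m hm =>
    eigenProj_eq_zero hD hm.symm (Submodule.smul_mem _ _ (eigenProj_mem hK m x))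

theorem absInv_eigenProj (hD : IsSelfAdjoint D) {K : H →L[ℂ] H} (hK : IsResolvent D K)
    (hKc : IsCompactOperator K) (l : ℝ) (x : H) :
    absInv D (eigenProj D l x) = ((|l|⁻¹ : ℝ) : ℂ) • eigenProj D l x := by
  refine (hasSum_absInv hD hK hKc (eigenProj D l x)).unique ?_
  have h2 : ((|l|⁻¹ : ℝ) : ℂ) • eigenProj D l x =
      ((|l|⁻¹ : ℝ) : ℂ) • eigenProj D l (eigenProj D l x) := by
    rw [eigenProj_eq_self (eigenProj_mem hK l x)]
  rw [h2]
  exact hasSum_single l fun m hm => by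
    rw [eigenProj_eq_zero hD hm (eigenProj_mem hK l x), smul_zero]

theorem hasSum_eigenProj_ne_zero (hD : IsSelfAdjoint D) {K : H →L[ℂ] H} (hK : IsResolvent D K)
    (hKc : IsCompactOperator K) (x : H) :
    HasSum (fun l : ℝ => ((|l| : ℝ) : ℂ) • ((|l|⁻¹ : ℝ) : ℂ) • eigenProj D l x)
      (x - eigenProj D 0 x) := by
  have h1 := (hasSum_eigenProj hD hK hKc x).update 0 0
  rw [zero_sub, neg_add_eq_sub] at h1
  convert h1 using 2 with l
  rcases eq_or_ne l 0 with rfl | hl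
  · simp
  · rw [Function.update_of_ne hl, smul_smul, ← Complex.ofReal_mul,
      mul_inv_cancel₀ (abs_ne_zero.2 hl), Complex.ofReal_one, one_smul]

/-- `|D|⁻¹` maps into the domain of `|D|`, and `|D| |D|⁻¹ = 1 - P_0`. -/
theorem absOp_absInv (hD : IsSelfAdjoint D) {K : H →L[ℂ] H} (hK : IsResolvent D K)
    (hKc : IsCompactOperator K) (x : H) :
    ∃ h : absInv D x ∈ (absOp D).domain, absOp D ⟨absInv D x, h⟩ = x - eigenProj D 0 x := by
  have h1 := hasSum_eigenProj_ne_zero hD hK hKc x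
  have h2 : (fun l : ℝ => ((|l| : ℝ) : ℂ) • ((|l|⁻¹ : ℝ) : ℂ) • eigenProj D l x) =
      fun l : ℝ => ((|l| : ℝ) : ℂ) • eigenProj D l (absInv D x) :=
    funext fun l => by rw [eigenProj_absInv hD hK hKc]
  rw [h2] at h1
  exact ⟨h1.summable, h1.tsum_eq⟩

/-- `|D|⁻¹ |D| = 1 - P_0` on the domain of `|D|`. -/
theorem absInv_absOp (hD : IsSelfAdjoint D) {K : H →L[ℂ] H} (hK : IsResolvent D K)
    (hKc : IsCompactOperator K) (x : (absOp D).domain) :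
    absInv D (absOp D x) = (x : H) - eigenProj D 0 x := by
  have h1 : HasSum (fun l : ℝ => ((|l| : ℝ) : ℂ) • eigenProj D l (x : H)) (absOp D x) :=
    Summable.hasSum x.2
  have h2 := h1.mapL (absInv D)
  have h3 := hasSum_eigenProj_ne_zero hD hK hKc (x : H)
  refine h2.unique ?_
  convert h3 using 2 with l
  rw [map_smul, absInv_eigenProj hD hK hKc]

/-- If `[|D|, b] = c` is bounded then, up to finite rank, `[b, |D|⁻¹] = |D|⁻¹ c |D|⁻¹`. -/
theorem mul_absInv_sub_absInv_mul (hD : IsSelfAdjoint D) {K : H →L[ℂ] H} (hK : IsResolvent D K)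
    (hKc : IsCompactOperator K) {b c : H →L[ℂ] H} (h : HasCommutator (absOp D) b c) :
    b * absInv D - absInv D * b = absInv D * c * absInv D +
      (eigenProj D 0 * (b * absInv D) - absInv D * b * eigenProj D 0) := by
  ext x
  obtain ⟨h1, e1⟩ := absOp_absInv hD hK hKc x
  obtain ⟨h2, e2⟩ := h ⟨absInv D x, h1⟩
  have e3 := congrArg (absInv D) e2
  rw [map_sub, absInv_absOp hD hK hKc, e1, map_sub, map_sub] at e3
  change b (absInv D x) - absInv D (b x) = absInv D (c (absInv D x)) +
    (eigenProj D 0 (b (absInv D x)) - absInv D (b (eigenProj D 0 x)))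
  change b (absInv D x) - eigenProj D 0 (b (absInv D x)) -
    (absInv D (b x) - absInv D (b (eigenProj D 0 x))) = absInv D (c (absInv D x)) at e3
  rw [← e3]
  abel

theorem rank_eigenProj_le {K : H →L[ℂ] H} (hK : IsResolvent D K) (hKc : IsCompactOperator K)
    (l : ℝ) : ∃ n : ℕ, LinearMap.rank (eigenProj D l : H →ₗ[ℂ] H) ≤ (n : Cardinal) := by
  have hfin := finiteDimensional_eigenspace hK hKc l
  refine ⟨Module.finrank ℂ (eigenspace D l), ?_⟩
  rw [Module.finrank_eq_rank]
  refine Submodule.rank_mono ?_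
  rintro _ ⟨x, rfl⟩
  exact eigenProj_mem hK l x

theorem commutator_absInv_cube_mem_weakSchatten (hD : IsSelfAdjoint D)
    (hDc : HasCompactResolvent D) (hR : absInv D ∈ weakSchatten H (1 / 3)) {b c : H →L[ℂ] H}
    (h : HasCommutator (absOp D) b c) :
    b * absInv D ^ 3 - absInv D ^ 3 * b ∈ weakSchatten H (4 / 3) := by
  obtain ⟨K, hKc, hK⟩ := hDc
  obtain ⟨n, hn⟩ := rank_eigenProj_le (D := D) hK hKc 0
  set R := absInv D
  have h3 : (0 : ℝ) ≤ 1 / 3 := by norm_num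
  have h23 : (0 : ℝ) ≤ 1 / 3 + 1 / 3 := by norm_num
  have hX : b * R - R * b ∈ weakSchatten H (1 / 3 + 1 / 3) := by
    rw [mul_absInv_sub_absInv_mul hD hK hKc h]
    refine weakSchatten_add h23 ?_ (weakSchatten_sub h23 ?_ ?_)
    · exact weakSchatten_mul h3 h3 (weakSchatten_mul_right h3 hR c) hR
    · exact weakSchatten_of_rank_le h23 (rank_clm_mul_le_left hn _)
    · exact weakSchatten_of_rank_le h23 (rank_clm_mul_le_right hn _)
  set X := b * R - R * b with hXdef
  have e : b * R ^ 3 - R ^ 3 * b = X * (R * R) + R * X * R + R * R * X := by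
    rw [hXdef]
    noncomm_ring
  have hRR := weakSchatten_mul h3 h3 hR hR
  have e43 : (4 / 3 : ℝ) = 1 / 3 + 1 / 3 + (1 / 3 + 1 / 3) := by norm_num
  have e43' : (4 / 3 : ℝ) = 1 / 3 + (1 / 3 + 1 / 3) + 1 / 3 := by norm_num
  have h43 : (0 : ℝ) ≤ 4 / 3 := by norm_num
  rw [e]
  refine weakSchatten_add h43 (weakSchatten_add h43 ?_ ?_) ?_
  · rw [e43]
    exact weakSchatten_mul h23 h23 hX hRR
  · rw [e43']
    exact weakSchatten_mul (by norm_num) h3 (weakSchatten_mul h3 h23 hR hX) hR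
  · rw [e43]
    exact weakSchatten_mul h23 h23 hRR hX

end Spectral

/-! ### Closed traces on first-order differential calculi -/

section Cycle

/-- The algebraic data extracted from a spectral triple of dimension three: a representation `π` of
`A` in `B`, a `B`-valued derivation `d` over `π`, and a continuous linear form `τ` on `B` that is
tracial against `π(A)` and `dA` and vanishes on the products `da db dc`. -/
structure ThreeCycle (A B : Type*) [Ring A] [Algebra ℂ A] [NormedRing B] [NormedAlgebra ℂ B] where
  π : A →ₐ[ℂ] B
  d : A →ₗ[ℂ] B
  τ : B →L[ℂ] ℂ
  leibniz : ∀ a b, d (a * b) = d a * π b + π a * d b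
  trace_π : ∀ x a, τ (x * π a) = τ (π a * x)
  trace_d : ∀ x a, τ (x * d a) = τ (d a * x)
  closed : ∀ a b c, τ (d a * d b * d c) = 0

namespace ThreeCycle

variable {A B : Type*} [Ring A] [Algebra ℂ A] [NormedRing B] [NormedAlgebra ℂ B]
  (C : ThreeCycle A B)

theorem d_one : C.d 1 = 0 := by
  have h := C.leibniz 1 1
  rw [mul_one, map_one C.π, mul_one, one_mul] at h
  exact left_eq_add.1 h

theorem π_mul_d_of_mul_eq_one {u v : A} (h : u * v = 1) : C.π u * C.d v = -(C.d u * C.π v) := by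
  have h1 := C.leibniz u v
  rw [h, C.d_one] at h1
  exact (neg_eq_of_add_eq_zero_right h1.symm).symm

/-- The 4-linear form `τ(a₀ da₁ da₂ da₃)`. -/
noncomputable def character (a₀ a₁ a₂ a₃ : A) : ℂ := C.τ (C.π a₀ * C.d a₁ * C.d a₂ * C.d a₃)

theorem character_hochschild (a₀ a₁ a₂ a₃ a₄ : A) :
    C.character (a₀ * a₁) a₂ a₃ a₄ - C.character a₀ (a₁ * a₂) a₃ a₄ +
      C.character a₀ a₁ (a₂ * a₃) a₄ - C.character a₀ a₁ a₂ (a₃ * a₄) +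
      C.character (a₄ * a₀) a₁ a₂ a₃ = 0 := by
  have h := C.trace_π (C.π a₀ * C.d a₁ * C.d a₂ * C.d a₃) a₄
  simp only [character, C.leibniz, map_mul]
  rw [← sub_eq_zero, ← map_sub] at h
  rw [← map_sub, ← map_add, ← map_sub, ← map_add, ← neg_eq_zero, ← map_neg, ← h]
  congr 1
  noncomm_ring

theorem character_cyclic (a₀ a₁ a₂ a₃ : A) :
    C.character a₀ a₁ a₂ a₃ = -C.character a₁ a₂ a₃ a₀ := by
  have h1 := C.closed (a₀ * a₁) a₂ a₃
  have h2 := C.trace_d (C.π a₁ * C.d a₂ * C.d a₃) a₀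
  rw [C.leibniz, add_mul, add_mul, map_add] at h1
  rw [character, character, h2, eq_neg_iff_add_eq_zero, add_comm, ← h1]
  simp only [mul_assoc]

theorem isCyclicThreeCocycle_const_mul_character (c : ℂ) :
    IsCyclicThreeCocycle fun a₀ a₁ a₂ a₃ : A => c * C.character a₀ a₁ a₂ a₃ where
  multilinear := by
    refine ⟨MultilinearMap.mk' (fun v => c * C.character (v 0) (v 1) (v 2) (v 3)) ?_ ?_,
      fun a₀ a₁ a₂ a₃ => rfl⟩
    · intro v i x y
      fin_cases i <;> simp [character, Function.update, mul_add, add_mul]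
    · intro v i r x
      fin_cases i <;> simp [character, Function.update, mul_left_comm]
  hochschild a₀ a₁ a₂ a₃ a₄ := by
    rw [← mul_sub, ← mul_add, ← mul_sub, ← mul_add, C.character_hochschild, mul_zero]
  cyclic a₀ a₁ a₂ a₃ := by
    rw [C.character_cyclic, mul_neg]

/-- The identity behind the second assertion: for `v = u⁻¹` one has `u (dv) u = -du`. -/
theorem trace_cube_eq_neg_character {u v : A} (huv : u * v = 1) (hvu : v * u = 1) :
    C.τ ((C.π u * C.d v) ^ 3) = -C.character (u - 1) (v - 1) (u - 1) (v - 1) := by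
  have hd : ∀ a : A, C.d (a - 1) = C.d a := fun a => by rw [map_sub, C.d_one, sub_zero]
  have h1 := C.π_mul_d_of_mul_eq_one huv
  have hu : C.π v * C.π u = 1 := by rw [← map_mul, hvu, map_one]
  have h2 : C.π u * C.d v * C.π u = -C.d u := by
    rw [h1, neg_mul, mul_assoc, hu, mul_one]
  rw [character, hd, hd, map_sub, map_one, sub_mul, sub_mul, sub_mul, one_mul, map_sub,
    C.closed, sub_zero, ← map_neg]
  congr 1
  calc (C.π u * C.d v) ^ 3 = C.π u * C.d v * (C.π u * C.d v * C.π u) * C.d v := by noncomm_ring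
    _ = _ := by rw [h2]; noncomm_ring

/-- `τ((u du⁻¹)³) = -τ((u⁻¹ du)³)`. -/
theorem trace_cube_eq_neg_trace_cube {u v : A} (huv : u * v = 1) :
    C.τ ((C.π u * C.d v) ^ 3) = -C.τ ((C.π v * C.d u) ^ 3) := by
  have h := C.trace_π (C.d u * (C.π v * C.d u) ^ 2) v
  rw [C.π_mul_d_of_mul_eq_one huv, ← map_neg]
  have e1 : (-(C.d u * C.π v)) ^ 3 = -(C.d u * (C.π v * C.d u) ^ 2 * C.π v) := by noncomm_ring
  rw [e1, map_neg, h, ← map_neg]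
  congr 1
  noncomm_ring

/-! ### Invertible elements of the closure -/

/-- If `π(g)` is invertible and has an approximate left inverse in `π(A)`, the truncated Neumann
series give elements of `A` converging to `π(g)⁻¹` together with their differentials. -/
theorem exists_tendsto_inverse {g h : A} {I : B} (hI : C.π g * I = 1)
    (hh : ‖1 - C.π h * C.π g‖ < 1) :
    ∃ k : ℕ → A, Filter.Tendsto (fun n => C.π (k n)) Filter.atTop (nhds I) ∧
      Filter.Tendsto (fun n => C.d (k n)) Filter.atTop (nhds (-(I * C.d g * I))) := by
  set y : A := 1 - h * g with hy
  have hπy : C.π y = 1 - C.π h * C.π g := by simp [hy]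
  have hr : ‖C.π y‖ < 1 := by rwa [hπy]
  set r := ‖C.π y‖ with hrdef
  have hpow : Filter.Tendsto (fun n => C.π (y ^ n)) Filter.atTop (nhds 0) := by
    simp only [map_pow]
    exact tendsto_pow_atTop_nhds_zero_of_norm_lt_one hr
  have hdbound : ∀ n : ℕ, ‖C.d (y ^ (n + 1))‖ ≤ ((n : ℝ) * r ^ n + r ^ n) * ‖C.d y‖ := by
    intro n
    induction n with
    | zero => simp
    | succ n ih =>
      rw [pow_succ y (n + 1), C.leibniz]
      have h1 : ‖C.π (y ^ (n + 1))‖ ≤ r ^ (n + 1) := by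
        rw [map_pow]
        exact norm_pow_le' _ n.succ_pos
      calc _ ≤ ‖C.d (y ^ (n + 1)) * C.π y‖ + ‖C.π (y ^ (n + 1)) * C.d y‖ := norm_add_le _ _
        _ ≤ ‖C.d (y ^ (n + 1))‖ * r + ‖C.π (y ^ (n + 1))‖ * ‖C.d y‖ :=
          add_le_add (norm_mul_le _ _) (norm_mul_le _ _)
        _ ≤ (((n : ℝ) * r ^ n + r ^ n) * ‖C.d y‖) * r + r ^ (n + 1) * ‖C.d y‖ := by gcongr
        _ = _ := by push_cast; ring
  have hd : Filter.Tendsto (fun n => C.d (y ^ n)) Filter.atTop (nhds 0) := by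
    rw [← Filter.tendsto_add_atTop_iff_nat 1]
    refine squeeze_zero_norm hdbound ?_
    have h1 := tendsto_self_mul_const_pow_of_lt_one (norm_nonneg (C.π y)) hr
    have h2 := tendsto_pow_atTop_nhds_zero_of_lt_one (norm_nonneg (C.π y)) hr
    simpa using (h1.add h2).mul_const ‖C.d y‖
  set k : ℕ → A := fun n => (∑ i ∈ Finset.range n, y ^ i) * h with hk
  have hkg : ∀ n, k n * g = 1 - y ^ n := fun n => by
    have e : h * g = 1 - y := by rw [hy]; abel
    rw [hk, mul_assoc, e]
    exact geom_sum_mul_neg y n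
  have hπk : ∀ n, C.π (k n) = (1 - C.π (y ^ n)) * I := fun n => by
    rw [← map_one C.π, ← map_sub, ← hkg n, map_mul C.π (k n) g, mul_assoc, hI, mul_one]
  have hdk : ∀ n, C.d (k n) = (-C.d (y ^ n) - C.π (k n) * C.d g) * I := fun n => by
    have h1 := C.leibniz (k n) g
    rw [hkg n, map_sub, C.d_one, zero_sub] at h1
    rw [h1, add_sub_cancel_right, mul_assoc, hI, mul_one]
  have hlim : Filter.Tendsto (fun n => C.π (k n)) Filter.atTop (nhds I) := by
    have h1 := ((tendsto_const_nhds (x := (1 : B))).sub hpow).mul_const I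
    rw [sub_zero, one_mul] at h1
    exact h1.congr fun n => (hπk n).symm
  refine ⟨k, hlim, ?_⟩
  have h2 := (hd.neg.sub (hlim.mul_const (C.d g))).mul_const I
  rw [neg_zero, zero_sub, neg_mul] at h2
  exact h2.congr fun n => (hdk n).symm

theorem trace_inverse {g : A} {I : B} (hI : C.π g * I = 1) (hI' : I * C.π g = 1) (x : B) :
    C.τ (x * I) = C.τ (I * x) := by
  have h := C.trace_π (I * x * I) g
  have e1 : I * x * I * C.π g = I * x := by rw [mul_assoc (I * x), hI', mul_one]
  have e2 : C.π g * (I * x * I) = x * I := by rw [← mul_assoc, ← mul_assoc, hI, one_mul]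
  rw [e1, e2] at h
  exact h.symm

/-- The derivative of `τ((g⁻¹ dg)³)` in the direction `k` vanishes: it is a multiple of
`τ(dg d(g⁻¹) d(k g⁻¹))`, which is zero by closedness and continuity. -/
theorem trace_variation_eq_zero {g h : A} (k : A) {I : B} (hI : C.π g * I = 1)
    (hI' : I * C.π g = 1) (hh : ‖1 - C.π h * C.π g‖ < 1) :
    C.τ (I * C.d g * (I * C.d g) * (I * C.d k - I * C.π k * I * C.d g)) = 0 := by
  obtain ⟨j, hj, hdj⟩ := C.exists_tendsto_inverse hI hh
  have h1 : Filter.Tendsto (fun n => C.τ (C.d g * C.d (j n) * C.d (k * j n))) Filter.atTop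
      (nhds (C.τ (C.d g * -(I * C.d g * I) * (C.d k * I + C.π k * -(I * C.d g * I))))) := by
    refine (C.τ.continuous.tendsto _).comp ((hdj.const_mul (C.d g)).mul ?_)
    simp only [C.leibniz]
    exact (hj.const_mul _).add (hdj.const_mul _)
  simp only [C.closed] at h1
  have h2 := tendsto_nhds_unique h1 tendsto_const_nhds
  have h3 := C.trace_inverse hI hI'
    (C.d g * (I * C.d g) * (I * C.d k - I * C.π k * I * C.d g))
  have e1 : C.d g * -(I * C.d g * I) * (C.d k * I + C.π k * -(I * C.d g * I)) =
      -(C.d g * (I * C.d g) * (I * C.d k - I * C.π k * I * C.d g) * I) := by noncomm_ring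
  rw [e1, map_neg, neg_eq_zero, h3] at h2
  rw [← h2]
  congr 1
  noncomm_ring

/-- The value `τ((g⁻¹ dg)³)` at an element `g` whose image in `B` is invertible. -/
noncomputable def invariant (g : A) : ℂ := C.τ ((Ring.inverse (C.π g) * C.d g) ^ 3)

theorem trace_inverse_mul_d {g : A} {I : B} (hI : C.π g * I = 1) (hI' : I * C.π g = 1) (x : B) :
    C.τ (x * (I * C.d g)) = C.τ (I * C.d g * x) := by
  rw [← mul_assoc, C.trace_d, ← mul_assoc, C.trace_inverse hI hI', mul_assoc]

variable [CompleteSpace B]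

/-- Along a segment of invertible elements the invariant is constant. -/
theorem invariant_eq_of_segment (g₀ g₁ : A)
    (hseg : ∀ t : ℝ, t ∈ Set.Icc (0 : ℝ) 1 → IsUnit (C.π (g₀ + (t : ℂ) • (g₁ - g₀))) ∧
      ∃ h : A, ‖1 - C.π h * C.π (g₀ + (t : ℂ) • (g₁ - g₀))‖ < 1) :
    C.invariant g₀ = C.invariant g₁ := by
  set p : ℝ → A := fun t => g₀ + (t : ℂ) • (g₁ - g₀) with hp
  have hlin : ∀ (L : A →ₗ[ℂ] B) (t : ℝ), HasDerivAt (fun s : ℝ => L (p s)) (L (g₁ - g₀)) t := by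
    intro L t
    have h1 : (fun s : ℝ => L (p s)) = fun s : ℝ => L g₀ + s • L (g₁ - g₀) := by
      funext s
      rw [hp, map_add, map_smul]
      rfl
    rw [h1]
    have h2 := ((hasDerivAt_id t).smul_const (L (g₁ - g₀))).const_add (L g₀)
    rwa [one_smul] at h2
  have hder : ∀ t ∈ Set.Icc (0 : ℝ) 1, HasDerivAt (fun s => C.invariant (p s)) 0 t := by
    intro t ht
    obtain ⟨hunit, h, hh⟩ := hseg t ht
    obtain ⟨U, hU⟩ := hunit
    set I : B := ↑U⁻¹ with hIdef
    have hI : C.π (p t) * I = 1 := by rw [← hU, hIdef, Units.mul_inv]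
    have hI' : I * C.π (p t) = 1 := by rw [← hU, hIdef, Units.inv_mul]
    have hinv : Ring.inverse (C.π (p t)) = I := by rw [← hU, Ring.inverse_unit]
    have d1 : HasDerivAt (fun s : ℝ => C.π (p s)) (C.π (g₁ - g₀)) t := hlin C.π.toLinearMap t
    have d2 : HasDerivAt (fun s : ℝ => C.d (p s)) (C.d (g₁ - g₀)) t := hlin C.d t
    have d3 : HasDerivAt (fun s : ℝ => Ring.inverse (C.π (p s)))
        (-(I * C.π (g₁ - g₀) * I)) t := by
      have h1 := hasFDerivAt_ringInverse (𝕜 := ℝ) U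
      rw [hU] at h1
      have h2 := h1.comp_hasDerivAt t d1
      rw [neg_apply, ContinuousLinearMap.mulLeftRight_apply] at h2
      exact h2
    set x := I * C.d (p t) with hx
    set x' := -(I * C.π (g₁ - g₀) * I) * C.d (p t) + I * C.d (g₁ - g₀) with hx'
    let F : ℝ → B := fun s => Ring.inverse (C.π (p s)) * C.d (p s)
    have hFt : F t = x := by rw [hx, ← hinv]
    have d4 : HasDerivAt F x' t := by
      have h1 := d3.mul d2
      rw [hinv] at h1
      exact h1
    have d5 : HasDerivAt (fun s => C.τ (F s * F s * F s))
        (C.τ ((x' * x + x * x') * x + x * x * x')) t := by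
      have h1 := (d4.mul d4).mul d4
      rw [Pi.mul_apply, hFt] at h1
      exact (C.τ.restrictScalars ℝ).hasFDerivAt.comp_hasDerivAt t h1
    have key : C.τ (x * x * x') = 0 := by
      have h0 := C.trace_variation_eq_zero (g₁ - g₀) hI hI' hh
      have e : x' = I * C.d (g₁ - g₀) - I * C.π (g₁ - g₀) * I * C.d (p t) := by
        rw [hx']
        noncomm_ring
      rw [e]
      exact h0
    have c1 : C.τ (x * x' * x) = 0 := by
      have h0 := C.trace_inverse_mul_d hI hI' (x * x')
      rwa [← hx, ← mul_assoc x x x', key] at h0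
    have c2 : C.τ (x' * x * x) = 0 := by
      have h0 := C.trace_inverse_mul_d hI hI' (x' * x)
      rwa [← hx, ← mul_assoc x x' x, c1] at h0
    rw [add_mul, map_add, map_add, key, c1, c2, add_zero, add_zero] at d5
    refine d5.congr_of_eventuallyEq (Filter.Eventually.of_forall fun s => ?_)
    simp only [invariant, pow_succ, pow_zero, one_mul, F]
  have hconst := constant_of_has_deriv_right_zero
    (fun t ht => (hder t ht).continuousAt.continuousWithinAt)
    (fun t ht => (hder t (Set.Ico_subset_Icc_self ht)).hasDerivWithinAt) 1 (by simp)
  simpa [hp] using hconst.symm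

/-- Two elements of `A` whose images are close to the same invertible `W`, with `W⁻¹ = V` in the
closure of `π(A)`, have the same invariant. -/
theorem invariant_eq_of_norm_lt {V : B} (hV : IsUnit V) (hVcl : V ∈ closure (Set.range C.π))
    {g₀ g₁ : A} (h₀ : ‖1 - V * C.π g₀‖ < 1) (h₁ : ‖1 - V * C.π g₁‖ < 1) :
    C.invariant g₀ = C.invariant g₁ := by
  refine C.invariant_eq_of_segment g₀ g₁ fun t ht => ?_
  set g : A := g₀ + (t : ℂ) • (g₁ - g₀) with hg
  have hlt : ‖1 - V * C.π g‖ < 1 := by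
    have e : 1 - V * C.π g = ((1 - t : ℝ) : ℂ) • (1 - V * C.π g₀) + (t : ℂ) • (1 - V * C.π g₁) := by
      rw [hg, map_add, map_smul, map_sub, mul_add, mul_smul_comm, mul_sub]
      push_cast
      module
    rw [e]
    have hball := convex_ball (0 : B) 1
    have := hball (x := 1 - V * C.π g₀) (by simpa using h₀) (y := 1 - V * C.π g₁)
      (by simpa using h₁) (a := 1 - t) (b := t) (by linarith [ht.2]) ht.1 (by ring)
    rw [mem_ball_zero_iff] at this
    exact this
  constructor
  · have h1 : IsUnit (V * C.π g) := by
      have := (Units.oneSub (1 - V * C.π g) hlt).isUnit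
      simpa using this
    exact (hV.mul_left_iff).1 h1
  · have hpos : 0 < (1 - ‖1 - V * C.π g‖) / (‖C.π g‖ + 1) := by
      have := norm_nonneg (C.π g)
      exact div_pos (by linarith) (by linarith)
    obtain ⟨_, ⟨h, rfl⟩, hh⟩ := Metric.mem_closure_iff.1 hVcl _ hpos
    refine ⟨h, ?_⟩
    have e : 1 - C.π h * C.π g = (1 - V * C.π g) + (V - C.π h) * C.π g := by noncomm_ring
    rw [dist_eq_norm, lt_div_iff₀ (by positivity)] at hh
    rw [e]
    have h2 : ‖(V - C.π h) * C.π g‖ ≤ ‖V - C.π h‖ * ‖C.π g‖ := norm_mul_le _ _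
    have h3 := norm_nonneg (V - C.π h)
    have h4 := norm_add_le (1 - V * C.π g) ((V - C.π h) * C.π g)
    nlinarith

/-- The invariant is constant near any `W` that is invertible in the closure of `π(A)`. -/
theorem exists_eventually_invariant_eq {W V : B} (hWV : W * V = 1) (hVW : V * W = 1)
    (hVcl : V ∈ closure (Set.range C.π)) :
    ∃ z : ℂ, ∀ᶠ g in Filter.comap C.π (nhds W), IsUnit (C.π g) ∧ C.invariant g = z := by
  have hV : IsUnit V := ⟨⟨V, W, hVW, hWV⟩, rfl⟩
  have hO : ∀ᶠ G in nhds W, ‖1 - V * G‖ < 1 := by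
    have hc : Continuous fun G : B => ‖1 - V * G‖ := by fun_prop
    refine hc.continuousAt.eventually_lt continuousAt_const ?_
    rw [hVW, sub_self, norm_zero]
    exact one_pos
  have hunit : ∀ G : B, ‖1 - V * G‖ < 1 → IsUnit G := fun G hG => by
    have := (Units.oneSub (1 - V * G) hG).isUnit
    exact (hV.mul_left_iff).1 (by simpa using this)
  by_cases hex : ∃ g₀ : A, ‖1 - V * C.π g₀‖ < 1
  · obtain ⟨g₀, h₀⟩ := hex
    refine ⟨C.invariant g₀, ?_⟩
    filter_upwards [Filter.tendsto_comap.eventually hO] with g hg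
    exact ⟨hunit _ hg, C.invariant_eq_of_norm_lt hV hVcl hg h₀⟩
  · refine ⟨0, ?_⟩
    filter_upwards [Filter.tendsto_comap.eventually hO] with g hg
    exact absurd ⟨g, hg⟩ hex

end ThreeCycle

end Cycle

/-! ### Matrices over a cycle -/

section MatrixCycle

open scoped Matrix.Norms.Operator

namespace ThreeCycle

variable {A B : Type*} [Ring A] [Algebra ℂ A] [NormedRing B] [NormedAlgebra ℂ B]
  (C : ThreeCycle A B)

/-- The cycle over `M_n(A)`: `π` and `d` act entrywise and `τ` is composed with the matrix trace.
The norm on `M_n(B)` is the operator norm for the supremum norm on columns; its topology is the one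
of entrywise convergence. -/
noncomputable def matrix (n : Type*) [Fintype n] [DecidableEq n] :
    ThreeCycle (Matrix n n A) (Matrix n n B) where
  π := C.π.mapMatrix
  d := C.d.mapMatrix
  τ := ⟨C.τ.toLinearMap ∘ₗ Matrix.traceLinearMap n ℂ B, by
    change Continuous fun X : Matrix n n B => C.τ X.trace
    exact C.τ.continuous.comp continuous_id.matrix_trace⟩
  leibniz a b := by
    ext i j
    simp only [LinearMap.mapMatrix_apply, AlgHom.mapMatrix_apply, Matrix.map_apply,
      Matrix.mul_apply, Matrix.add_apply, map_sum, C.leibniz, Finset.sum_add_distrib]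
  trace_π x a := by
    change C.τ (x * a.map C.π).trace = C.τ (a.map C.π * x).trace
    simp only [Matrix.trace, Matrix.diag_apply, Matrix.mul_apply, Matrix.map_apply, map_sum,
      C.trace_π]
    rw [Finset.sum_comm]
  trace_d x a := by
    change C.τ (x * a.map C.d).trace = C.τ (a.map C.d * x).trace
    simp only [Matrix.trace, Matrix.diag_apply, Matrix.mul_apply, Matrix.map_apply, map_sum,
      C.trace_d]
    rw [Finset.sum_comm]
  closed a b c := by
    change C.τ (a.map C.d * b.map C.d * c.map C.d).trace = 0
    simp only [Matrix.trace, Matrix.diag_apply, Matrix.mul_apply, Matrix.map_apply,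
      Finset.sum_mul, map_sum, C.closed, Finset.sum_const_zero]

theorem invariant_eq_of_inverse {g : A} {I : B} (hI : C.π g * I = 1) (hI' : I * C.π g = 1) :
    C.invariant g = C.τ ((I * C.d g) ^ 3) := by
  have h : Ring.inverse (C.π g) = I := Ring.inverse_unit ⟨C.π g, I, hI, hI'⟩
  rw [invariant, h]

end ThreeCycle

/-! ### Stabilization by an identity block -/

section Pad

variable {R S : Type*} [Ring R] [Ring S]

/-- The block matrix `diag(a, c)`, for a scalar `c` on the second block, with its rows and columns
numbered consecutively. -/
def padBlock {M : ℕ} (k : ℕ) (c : R) (a : Matrix (Fin M) (Fin M) R) :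
    Matrix (Fin (M + k)) (Fin (M + k)) R :=
  (Matrix.fromBlocks a 0 0 (Matrix.diagonal fun _ => c)).submatrix
    finSumFinEquiv.symm finSumFinEquiv.symm

theorem padBlock_mul {M : ℕ} (k : ℕ) (c c' : R) (a b : Matrix (Fin M) (Fin M) R) :
    padBlock k c a * padBlock k c' b = padBlock k (c * c') (a * b) := by
  simp [padBlock, Matrix.submatrix_mul_equiv, Matrix.fromBlocks_multiply]

theorem padBlock_one {M : ℕ} (k : ℕ) : padBlock k (1 : R) (1 : Matrix (Fin M) (Fin M) R) = 1 := by
  simp [padBlock, Matrix.fromBlocks_one]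

theorem padBlock_map {M : ℕ} (k : ℕ) (c : R) (a : Matrix (Fin M) (Fin M) R) (f : R → S)
    (hf : f 0 = 0) : (padBlock k c a).map f = padBlock k (f c) (a.map f) := by
  simp only [padBlock, ← Matrix.submatrix_map, Matrix.fromBlocks_map, Matrix.diagonal_map hf]
  congr 2 <;> ext <;> simp [hf]

theorem trace_padBlock_zero {M : ℕ} (k : ℕ) (a : Matrix (Fin M) (Fin M) R) :
    (padBlock k 0 a).trace = a.trace := by
  refine (Equiv.sum_comp finSumFinEquiv.symm
    (fun i => Matrix.fromBlocks a 0 0 (Matrix.diagonal fun _ : Fin k => 0) i i)).trans ?_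
  simp [Matrix.trace]

theorem padBlock_one_apply {M : ℕ} (k : ℕ) (a : Matrix (Fin M) (Fin M) R) (i j : Fin (M + k)) :
    padBlock k 1 a i j = padMatrix a i j := by
  induction i using Fin.addCases <;> induction j using Fin.addCases <;>
    simp [padBlock, padMatrix]
  case left.right i j => exact fun h => absurd h (by omega)
  case right.left i j => exact fun h => absurd h (by omega)
  case right.right i j => simp [Matrix.one_apply, Fin.ext_iff]

theorem continuous_padBlock [TopologicalSpace R] {M : ℕ} (k : ℕ) (c : R) :
    Continuous (padBlock k c : Matrix (Fin M) (Fin M) R → _) := by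
  unfold padBlock
  fun_prop

end Pad

namespace ThreeCycle

variable {A B : Type*} [Ring A] [Algebra ℂ A] [NormedRing B] [NormedAlgebra ℂ B]
  (C : ThreeCycle A B)

theorem matrix_π_padBlock {M : ℕ} (k : ℕ) (g : Matrix (Fin M) (Fin M) A) :
    (C.matrix (Fin (M + k))).π (padBlock k 1 g) = padBlock k 1 ((C.matrix (Fin M)).π g) := by
  have h := padBlock_map k (1 : A) g C.π (map_zero C.π)
  rwa [map_one] at h

theorem invariant_padBlock {M : ℕ} (k : ℕ) {g : Matrix (Fin M) (Fin M) A}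
    (hg : IsUnit ((C.matrix (Fin M)).π g)) :
    (C.matrix (Fin (M + k))).invariant (padBlock k 1 g) = (C.matrix (Fin M)).invariant g := by
  obtain ⟨U, hU⟩ := hg
  set I : Matrix (Fin M) (Fin M) B := ↑U⁻¹ with hIdef
  have hI : (C.matrix (Fin M)).π g * I = 1 := by rw [← hU, hIdef, Units.mul_inv]
  have hI' : I * (C.matrix (Fin M)).π g = 1 := by rw [← hU, hIdef, Units.inv_mul]
  have hd : (C.matrix (Fin (M + k))).d (padBlock k 1 g) =
      padBlock k 0 ((C.matrix (Fin M)).d g) := by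
    have h := padBlock_map k (1 : A) g C.d (map_zero C.d)
    rwa [C.d_one] at h
  rw [invariant_eq_of_inverse _ hI hI', invariant_eq_of_inverse (C.matrix (Fin (M + k)))
    (I := padBlock k 1 I), hd, padBlock_mul, mul_zero]
  · set X := I * (C.matrix (Fin M)).d g
    have h3 : padBlock k (0 : B) X ^ 3 = padBlock k 0 (X ^ 3) := by
      simp only [pow_succ, pow_zero, one_mul, padBlock_mul, mul_zero]
    rw [h3]
    exact congrArg C.τ (trace_padBlock_zero k (X ^ 3))
  · rw [matrix_π_padBlock, padBlock_mul, hI, mul_one, padBlock_one]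
  · rw [matrix_π_padBlock, padBlock_mul, hI', mul_one, padBlock_one]

end ThreeCycle

end MatrixCycle

/-! ### The cycle of a spectral triple -/

section Commutators

variable {H : Type*} [NormedAddCommGroup H] [InnerProductSpace ℂ H] {D : H →ₗ.[ℂ] H}

theorem HasCommutator.unique (hD : Dense (D.domain : Set H)) {b c c' : H →L[ℂ] H}
    (h : HasCommutator D b c) (h' : HasCommutator D b c') : c = c' := by
  refine DFunLike.coe_injective (Continuous.ext_on hD c.continuous c'.continuous fun x hx => ?_)
  obtain ⟨h1, e1⟩ := h ⟨x, hx⟩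
  obtain ⟨h2, e2⟩ := h' ⟨x, hx⟩
  exact e1.symm.trans e2

theorem HasCommutator.add {b b' c c' : H →L[ℂ] H} (h : HasCommutator D b c)
    (h' : HasCommutator D b' c') : HasCommutator D (b + b') (c + c') := fun x => by
  obtain ⟨h1, e1⟩ := h x
  obtain ⟨h2, e2⟩ := h' x
  refine ⟨D.domain.add_mem h1 h2, ?_⟩
  have e : (⟨(b + b') (x : H), D.domain.add_mem h1 h2⟩ : D.domain) =
      ⟨b x, h1⟩ + ⟨b' x, h2⟩ := rfl
  rw [e, LinearPMap.map_add, add_apply, add_apply, ← e1, ← e2]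
  abel

theorem HasCommutator.smul (r : ℂ) {b c : H →L[ℂ] H} (h : HasCommutator D b c) :
    HasCommutator D (r • b) (r • c) := fun x => by
  obtain ⟨h1, e1⟩ := h x
  refine ⟨D.domain.smul_mem r h1, ?_⟩
  have e : (⟨(r • b) (x : H), D.domain.smul_mem r h1⟩ : D.domain) = r • ⟨b x, h1⟩ := rfl
  rw [e, LinearPMap.map_smul, smul_apply, smul_apply, ← e1, smul_sub]

theorem HasCommutator.mul {b b' c c' : H →L[ℂ] H} (h : HasCommutator D b c)
    (h' : HasCommutator D b' c') : HasCommutator D (b * b') (c * b' + b * c') := fun x => by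
  obtain ⟨h1, e1⟩ := h' x
  obtain ⟨h2, e2⟩ := h ⟨b' x, h1⟩
  refine ⟨h2, ?_⟩
  change D ⟨b (b' x), h2⟩ - b (b' (D x)) = c (b' x) + b (c' x)
  rw [← e1, ← e2, map_sub]
  abel

end Commutators

namespace SpectralTriple

variable {A : Type*} [Ring A] [StarRing A] [Algebra ℂ A]
  {H : Type*} [NormedAddCommGroup H] [InnerProductSpace ℂ H] [CompleteSpace H]
  (T : SpectralTriple A H)

theorem hasCommutator_d (a : A) : HasCommutator T.D (T.π a) (T.d a) :=
  Classical.choose_spec (T.boundedCommutator a)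

theorem d_eq {a : A} {c : H →L[ℂ] H} (h : HasCommutator T.D (T.π a) c) : T.d a = c :=
  (T.hasCommutator_d a).unique T.selfAdjoint.dense_domain h

theorem absInv_mem_weakSchatten (hdim : T.HasDimension 3) :
    absInv T.D ∈ weakSchatten H (1 / 3) := by
  obtain ⟨C, hC, hbound⟩ := Asymptotics.bound_of_isBigO_nat_atTop hdim.2
  refine ⟨‖absInv T.D‖ + C * 2 ^ (1 / 3 : ℝ), fun k => ?_⟩
  rcases Nat.eq_zero_or_pos k with rfl | hk
  · have h1 := singularNumber_le_norm (absInv T.D) 0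
    have h2 : 0 ≤ C * 2 ^ (1 / 3 : ℝ) := by positivity
    simp only [Nat.cast_zero, zero_add, Real.one_rpow, mul_one]
    linarith
  · have hk' : (0 : ℝ) < k := by exact_mod_cast hk
    have h1 := hbound (x := k) (by positivity)
    rw [Real.norm_of_nonneg (singularNumber_nonneg _ _), Real.norm_of_nonneg (by positivity)] at h1
    have h2 : ((k : ℝ)) ^ (-(1 / ((3 : ℕ) : ℝ))) ≤
        2 ^ (1 / 3 : ℝ) * ((k : ℝ) + 1) ^ (-(1 / 3 : ℝ)) := by
      have hle : ((k : ℝ) + 1) / 2 ≤ k := by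
        have : (1 : ℝ) ≤ k := by exact_mod_cast hk
        linarith
      calc ((k : ℝ)) ^ (-(1 / ((3 : ℕ) : ℝ))) ≤ (((k : ℝ) + 1) / 2) ^ (-(1 / ((3 : ℕ) : ℝ))) :=
            Real.rpow_le_rpow_of_nonpos (by positivity) hle (by norm_num)
        _ = _ := by
            rw [Real.div_rpow (by positivity) (by norm_num), Nat.cast_ofNat,
              Real.rpow_neg (by norm_num : (0 : ℝ) ≤ 2)]
            field_simp
    have h3 : 0 ≤ ‖absInv T.D‖ * ((k : ℝ) + 1) ^ (-(1 / 3 : ℝ)) := by positivity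
    rw [add_mul, mul_assoc]
    have h4 := mul_le_mul_of_nonneg_left h2 hC.le
    linarith

theorem absInv_pow_mem_weakSchatten (hdim : T.HasDimension 3) :
    absInv T.D ^ 3 ∈ weakSchatten H 1 := by
  have h := T.absInv_mem_weakSchatten hdim
  have h3 : (0 : ℝ) ≤ 1 / 3 := by norm_num
  have e : (1 : ℝ) = 1 / 3 + 1 / 3 + 1 / 3 := by norm_num
  rw [e, pow_succ, pow_two]
  exact weakSchatten_mul (by norm_num) h3 (weakSchatten_mul h3 h3 h h) h

/-- The bounded linear form `b ↦ Tr_ω(b |D|⁻³)`. -/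
noncomputable def residue (hdim : T.HasDimension 3) (ω : DixmierLimit) :
    (H →L[ℂ] H) →L[ℂ] ℂ :=
  LinearMap.mkContinuousOfExistsBound
    { toFun := fun b => dixmierTrace ω (b * absInv T.D ^ 3)
      map_add' := fun b c => by
        have h := fun b => weakSchatten_mul_left zero_le_one b (T.absInv_pow_mem_weakSchatten hdim)
        rw [add_mul, dixmierTrace_add ω (h b) (h c)]
      map_smul' := fun r b => by
        rw [smul_mul_assoc, dixmierTrace_smul ω r
          (weakSchatten_mul_left zero_le_one b (T.absInv_pow_mem_weakSchatten hdim))]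
        rfl } (by
    obtain ⟨C, hC⟩ := T.absInv_pow_mem_weakSchatten hdim
    refine ⟨12 * C, fun b => ?_⟩
    refine (norm_dixmierTrace_le ω (C := ‖b‖ * C) fun k => ?_).trans (le_of_eq (by ring))
    rw [mul_assoc]
    exact (singularNumber_mul_left_le _ _ k).trans
      (mul_le_mul_of_nonneg_left (hC k) (norm_nonneg b)))

theorem residue_apply (hdim : T.HasDimension 3) (ω : DixmierLimit) (b : H →L[ℂ] H) :
    T.residue hdim ω b = dixmierTrace ω (b * absInv T.D ^ 3) := rfl

/-- The residue is tracial against operators with bounded commutator with `|D|`: these commute with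
`|D|⁻³` up to trace class operators. -/
theorem residue_mul_comm (hdim : T.HasDimension 3) (ω : DixmierLimit) (x : H →L[ℂ] H)
    {b c : H →L[ℂ] H} (h : HasCommutator (absOp T.D) b c) :
    T.residue hdim ω (x * b) = T.residue hdim ω (b * x) := by
  have hS := T.absInv_pow_mem_weakSchatten hdim
  have hcomm := commutator_absInv_cube_mem_weakSchatten T.selfAdjoint T.compactResolvent
    (T.absInv_mem_weakSchatten hdim) h
  have h43 : (0 : ℝ) ≤ 4 / 3 := by norm_num
  have h1 := dixmierTrace_eq_zero ω (by norm_num) (weakSchatten_mul_left h43 x hcomm)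
  have hxS := weakSchatten_mul_left zero_le_one x hS
  have e1 : x * (b * absInv T.D ^ 3 - absInv T.D ^ 3 * b) =
      x * b * absInv T.D ^ 3 - x * absInv T.D ^ 3 * b := by
    rw [mul_sub, ← mul_assoc, ← mul_assoc]
  rw [e1, dixmierTrace_sub ω (weakSchatten_mul_left zero_le_one _ hS)
    (weakSchatten_mul_right zero_le_one hxS b), sub_eq_zero] at h1
  rw [residue_apply, residue_apply, h1, mul_assoc b, dixmierTrace_mul_comm ω b hxS]

/-- The cycle `(π, d, Tr_ω(· |D|⁻³))` of a regular three-dimensional spectral triple satisfying the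
closedness condition. -/
noncomputable def cycle (hdim : T.HasDimension 3) (hreg : T.Regular) (ω : DixmierLimit)
    (hclosed : T.Closed ω) : ThreeCycle A (H →L[ℂ] H) where
  π := T.π.toAlgHom
  d :=
    { toFun := T.d
      map_add' := fun a b => T.d_eq (by
        rw [map_add]
        exact (T.hasCommutator_d a).add (T.hasCommutator_d b))
      map_smul' := fun r a => T.d_eq (by
        rw [map_smul]
        exact (T.hasCommutator_d a).smul r) }
  τ := T.residue hdim ω
  leibniz a b := T.d_eq (by
    rw [map_mul]
    exact (T.hasCommutator_d a).mul (T.hasCommutator_d b))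
  trace_π x a := by
    obtain ⟨c, hc, -⟩ := hreg (T.π a) (Algebra.subset_adjoin (Or.inl ⟨a, rfl⟩)) 1
    exact T.residue_mul_comm hdim ω x hc
  trace_d x a := by
    obtain ⟨c, hc, -⟩ := hreg (T.d a) (Algebra.subset_adjoin (Or.inr ⟨a, rfl⟩)) 1
    exact T.residue_mul_comm hdim ω x hc
  closed a b c := hclosed a b c

end SpectralTriple

/-! ### The invariant on the stable unitary group of the closure -/

section Value

open scoped Matrix.Norms.Operator

namespace ThreeCycle

variable {A B : Type*} [Ring A] [Algebra ℂ A] [NormedRing B] [NormedAlgebra ℂ B]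
  (C : ThreeCycle A B)

/-- `z` is the value of the invariant at the matrix `W` over `B`: all `g ∈ M_N(A)` with `π(g)`
close enough to `W` are invertible in `M_N(B)` and have invariant `z`. -/
def HasValue {N : ℕ} (W : Matrix (Fin N) (Fin N) B) (z : ℂ) : Prop :=
  ∀ᶠ g in Filter.comap (C.matrix (Fin N)).π (nhds W),
    IsUnit ((C.matrix (Fin N)).π g) ∧ (C.matrix (Fin N)).invariant g = z

variable {C}

theorem mem_closure_range_matrix_π {N : ℕ} {W : Matrix (Fin N) (Fin N) B}
    (hW : ∀ i j, W i j ∈ closure (Set.range C.π)) :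
    W ∈ closure (Set.range (C.matrix (Fin N)).π) := by
  have h1 : W ∈ closure (Set.pi Set.univ fun _ : Fin N => Set.pi Set.univ fun _ : Fin N =>
      Set.range C.π) := by
    rw [closure_pi_set]
    intro i _
    rw [closure_pi_set]
    exact fun j _ => hW i j
  refine closure_mono (fun X hX => ?_) h1
  choose a ha using fun i j => hX i trivial j trivial
  exact ⟨Matrix.of a, Matrix.ext ha⟩

/-- The value is unique at entrywise limits of elements of `π(A)`: there the condition is not
vacuous. -/
theorem HasValue.eq {N : ℕ} {W : Matrix (Fin N) (Fin N) B} {z z' : ℂ}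
    (hW : ∀ i j, W i j ∈ closure (Set.range C.π)) (h : C.HasValue W z) (h' : C.HasValue W z') :
    z = z' := by
  have := Filter.comap_neBot_iff_frequently.2
    (mem_closure_iff_frequently.1 (mem_closure_range_matrix_π hW))
  obtain ⟨g, hg, hg'⟩ := (h.and h').exists
  exact hg.2.symm.trans hg'.2

/-- Any `W'` close to `W` has neighbourhoods contained in those of `W`, so it has the same value. -/
theorem HasValue.eventually {N : ℕ} {W : Matrix (Fin N) (Fin N) B} {z : ℂ}
    (h : C.HasValue W z) : ∀ᶠ W' in nhds W, C.HasValue W' z := by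
  filter_upwards [eventually_eventually_nhds.2 (Filter.eventually_comap.1 h)] with W' hW'
  exact Filter.eventually_comap.2 hW'

theorem HasValue.invariant_eq {N : ℕ} {g : Matrix (Fin N) (Fin N) A} {z : ℂ}
    (h : C.HasValue ((C.matrix (Fin N)).π g) z) : (C.matrix (Fin N)).invariant g = z :=
  ((Filter.eventually_comap.1 h).self_of_nhds g rfl).2

theorem HasValue.padBlock_eq {M k : ℕ} {W : Matrix (Fin M) (Fin M) B} {z z' : ℂ}
    (hW : ∀ i j, W i j ∈ closure (Set.range C.π)) (h : C.HasValue W z)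
    (h' : C.HasValue (padBlock k 1 W) z') : z = z' := by
  have := Filter.comap_neBot_iff_frequently.2
    (mem_closure_iff_frequently.1 (mem_closure_range_matrix_π hW))
  have ht : Filter.Tendsto (padBlock k (1 : A)) (Filter.comap (C.matrix (Fin M)).π (nhds W))
      (Filter.comap (C.matrix (Fin (M + k))).π (nhds (padBlock k 1 W))) := by
    rw [Filter.tendsto_comap_iff]
    have h1 := ((continuous_padBlock k (1 : B)).tendsto W).comp
      (Filter.tendsto_comap (f := (C.matrix (Fin M)).π))
    exact h1.congr fun g => (C.matrix_π_padBlock k g).symm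
  obtain ⟨g, hg, hg'⟩ := (h.and (ht.eventually h')).exists
  rw [← hg.2, ← hg'.2, C.invariant_padBlock k hg.1]

variable [CompleteSpace B]

theorem exists_hasValue {N : ℕ} {W V : Matrix (Fin N) (Fin N) B} (hWV : W * V = 1)
    (hVW : V * W = 1) (hV : ∀ i j, V i j ∈ closure (Set.range C.π)) :
    ∃ z, C.HasValue W z :=
  have : @CompleteSpace (Matrix (Fin N) (Fin N) B) PseudoMetricSpace.toUniformSpace :=
    inferInstanceAs (CompleteSpace (Fin N → Fin N → B))
  (C.matrix (Fin N)).exists_eventually_invariant_eq hWV hVW (mem_closure_range_matrix_π hV)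

variable [StarRing B] [StarModule ℂ B] {S : StarSubalgebra ℂ B}

theorem exists_hasValue_unitary (hS : (S : Set B) ⊆ closure (Set.range C.π)) {N : ℕ}
    (w : UN S N) : ∃ z, C.HasValue ((w : Matrix (Fin N) (Fin N) S).map S.subtype) z := by
  refine exists_hasValue (V := (star (w : Matrix (Fin N) (Fin N) S)).map S.subtype) ?_ ?_
    fun i j => hS (Subtype.mem _)
  · rw [← Matrix.map_mul, Unitary.mul_star_self_of_mem w.2]
    exact Matrix.map_one _ (map_zero S.subtype) (map_one S.subtype)
  · rw [← Matrix.map_mul, Unitary.star_mul_self_of_mem w.2]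
    exact Matrix.map_one _ (map_zero S.subtype) (map_one S.subtype)

/-- Over a `*`-algebra contained in the closure of `π(A)`, the value of the invariant at a unitary
matrix only depends on its class in `K_1`. -/
theorem HasValue.eq_of_k1_eq (hS : (S : Set B) ⊆ closure (Set.range C.π)) {M N : ℕ}
    {w : UN S M} {w' : UN S N} (hw : K1.mk w = K1.mk w') {z z' : ℂ}
    (h : C.HasValue ((w : Matrix (Fin M) (Fin M) S).map S.subtype) z)
    (h' : C.HasValue ((w' : Matrix (Fin N) (Fin N) S).map S.subtype) z') : z = z' := by
  choose value hvalue using fun (n : ℕ) (w : UN S n) => exists_hasValue_unitary hS w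
  have hcl : ∀ {n : ℕ} (w : UN S n) (i j : Fin n),
      (w : Matrix (Fin n) (Fin n) S).map S.subtype i j ∈ closure (Set.range C.π) :=
    fun w i j => hS (Subtype.mem _)
  -- The value is compatible with the embeddings `w ↦ diag(w, 1)`, hence descends to `U_∞`.
  have hle : ∀ (m k : ℕ) (w : UN S m) (w' : UN S (m + k)), UInf.incl w = UInf.incl w' →
      value m w = value (m + k) w' := by
    intro m k w w' hww
    refine HasValue.padBlock_eq (k := k) (hcl w) (hvalue m w) ?_
    have e : (w' : Matrix (Fin (m + k)) (Fin (m + k)) S) = padBlock k 1 w := by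
      ext1 i j
      rw [padBlock_one_apply]
      have h1 := congrFun (congrFun (congrArg Subtype.val hww) i) j
      refine Eq.trans ?_ h1.symm
      simp [UInf.incl, padMatrix]
    have h2 := hvalue (m + k) w'
    rwa [e, padBlock_map _ _ _ _ (map_zero S.subtype), map_one] at h2
  have hincl : ∀ (m n : ℕ) (w : UN S m) (w' : UN S n), UInf.incl w = UInf.incl w' →
      value m w = value n w' := by
    intro m n w w' hww
    rcases le_total m n with hmn | hmn
    · obtain ⟨k, rfl⟩ := Nat.exists_eq_add_of_le hmn
      exact hle m k w w' hww
    · obtain ⟨k, rfl⟩ := Nat.exists_eq_add_of_le hmn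
      exact (hle n k w' w hww.symm).symm
  set F : UInf S → ℂ := fun x => value x.2.choose x.2.choose_spec.choose with hF
  have hFincl : ∀ (n : ℕ) (w : UN S n), F (UInf.incl w) = value n w := fun n w =>
    hincl _ _ _ _ (Subtype.ext (UInf.incl w).2.choose_spec.choose_spec)
  -- For the inductive limit topology it is enough to check local constancy on each `U_n`.
  have hFloc : IsLocallyConstant F := by
    intro s
    refine isOpen_iSup_iff.2 fun n => isOpen_coinduced.2 ?_
    have hloc : IsLocallyConstant (value n) := by
      refine (IsLocallyConstant.iff_eventually_eq _).2 fun w => ?_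
      have hc : Continuous fun w : UN S n =>
          (w : Matrix (Fin n) (Fin n) S).map S.subtype :=
        continuous_subtype_val.matrix_map continuous_subtype_val
      filter_upwards [hc.continuousAt.eventually (hvalue n w).eventually] with w₁ h₁
      exact (hvalue n w₁).eq (hcl w₁) h₁
    have e : (fun u : UN S n => UInf.incl u) ⁻¹' (F ⁻¹' s) = value n ⁻¹' s := by
      ext u
      simp only [Set.mem_preimage, hFincl]
    rw [e]
    exact hloc s
  have hcomp : connectedComponent (UInf.incl w) = connectedComponent (UInf.incl w') :=
    ConnectedComponents.coe_eq_coe.1 hw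
  have hFeq : F (UInf.incl w) = F (UInf.incl w') :=
    hFloc.apply_eq_of_isPreconnected isPreconnected_connectedComponent mem_connectedComponent
      (hcomp ▸ mem_connectedComponent)
  rw [hFincl, hFincl] at hFeq
  rw [h.eq (hcl w) (hvalue M w), h'.eq (hcl w') (hvalue N w'), hFeq]

end ThreeCycle

end Value

/-! ### Functoriality of `K_1` -/

section Functoriality

variable {R S : Type*} [Ring R] [StarRing R] [Algebra ℂ R] [Ring S] [StarRing S] [Algebra ℂ S]

theorem padMatrix_map (f : R →⋆ₐ[ℂ] S) {N : ℕ} (a : Matrix (Fin N) (Fin N) R) :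
    (padMatrix a).map f = padMatrix (a.map f) := by
  ext i j
  simp only [padMatrix, Matrix.map_apply, Matrix.of_apply, apply_dite f, apply_ite f, map_one,
    map_zero]

theorem K1.mk_map_eq [TopologicalSpace R] [TopologicalSpace S] {f : R →⋆ₐ[ℂ] S}
    (hf : Continuous f) {M N : ℕ} {u : UN R M} {v : UN R N} (h : K1.mk u = K1.mk v) :
    K1.mk (UN.map f u) = K1.mk (UN.map f v) := by
  let φ : UInf R → UInf S := fun g => ⟨g.1.map f, by
    obtain ⟨n, w, hw⟩ := g.2
    exact ⟨n, UN.map f w, by rw [← hw, padMatrix_map]; rfl⟩⟩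
  have hincl : ∀ {n : ℕ} (w : UN R n), φ (UInf.incl w) = UInf.incl (UN.map f w) :=
    fun w => Subtype.ext (padMatrix_map f _)
  have hφ : Continuous φ := by
    refine continuous_iSup_dom.2 fun n => continuous_coinduced_dom.2 ?_
    have hc : Continuous fun w : UN R n => (UN.map f w : UN S n) :=
      (continuous_subtype_val.matrix_map hf).subtype_mk _
    have hi : Continuous fun w : UN S n => UInf.incl w :=
      continuous_iSup_rng (i := n) continuous_coinduced_rng
    exact (hi.comp hc).congr fun w => (hincl w).symm
  have h1 := congrArg hφ.connectedComponentsMap h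
  change ConnectedComponents.mk (φ (UInf.incl u)) = ConnectedComponents.mk (φ (UInf.incl v)) at h1
  rwa [hincl, hincl] at h1

end Functoriality

/-! ### The form `Φ̃` and the invariant `Γ` of a spectral triple -/

section SpectralTriple

open scoped Matrix.Norms.Operator

namespace SpectralTriple

variable {A : Type*} [Ring A] [StarRing A] [Algebra ℂ A]
  {H : Type*} [NormedAddCommGroup H] [InnerProductSpace ℂ H] [CompleteSpace H]
  (T : SpectralTriple A H)

/-- The normalization constant of the noncommutative integral in dimension three. -/
noncomputable def integralConst : ℂ :=
  ((Real.pi ^ (3 / 2 : ℝ) * Real.Gamma (3 / 2 + 1) / (2 : ℝ) ^ ((1 : ℤ) - 3) : ℝ) : ℂ)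

variable {T} {ω : DixmierLimit}

theorem PhiTilde_eq_character
    (hdim : T.HasDimension 3) (hreg : T.Regular) (hclosed : T.Closed ω)
    {N : ℕ} (a₀ a₁ a₂ a₃ : Matrix (Fin N) (Fin N) A) :
    T.PhiTilde ω a₀ a₁ a₂ a₃ =
      integralConst * ((T.cycle hdim hreg ω hclosed).matrix (Fin N)).character a₀ a₁ a₂ a₃ := rfl

theorem Gamma_eq_trace_cube
    (hdim : T.HasDimension 3) (hreg : T.Regular) (hclosed : T.Closed ω)
    {N : ℕ} (u : UN A N) :
    T.Gamma ω u = -(1 / 3 : ℂ) * (integralConst *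
      ((T.cycle hdim hreg ω hclosed).matrix (Fin N)).τ
        ((((T.cycle hdim hreg ω hclosed).matrix (Fin N)).π u *
          ((T.cycle hdim hreg ω hclosed).matrix (Fin N)).d
            (star (u : Matrix (Fin N) (Fin N) A))) ^ 3)) := rfl

theorem isCyclicThreeCocycle_PhiTilde
    (hdim : T.HasDimension 3) (hreg : T.Regular) (hclosed : T.Closed ω)
    (N : ℕ) : IsCyclicThreeCocycle
    fun a₀ a₁ a₂ a₃ : Matrix (Fin N) (Fin N) A => T.PhiTilde ω a₀ a₁ a₂ a₃ :=
  ((T.cycle hdim hreg ω hclosed).matrix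
    (Fin N)).isCyclicThreeCocycle_const_mul_character integralConst

theorem Gamma_eq_PhiTilde
    (hdim : T.HasDimension 3) (hreg : T.Regular) (hclosed : T.Closed ω)
    {N : ℕ} (u : UN A N) : T.Gamma ω u = (1 / 3 : ℂ) *
    T.PhiTilde ω ((u : Matrix (Fin N) (Fin N) A) - 1) (star (u : Matrix (Fin N) (Fin N) A) - 1)
      ((u : Matrix (Fin N) (Fin N) A) - 1) (star (u : Matrix (Fin N) (Fin N) A) - 1) := by
  rw [Gamma_eq_trace_cube hdim hreg hclosed,
    ThreeCycle.trace_cube_eq_neg_character _ (Unitary.mul_star_self_of_mem u.2)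
      (Unitary.star_mul_self_of_mem u.2), PhiTilde_eq_character hdim hreg hclosed]
  ring

/-- `Γ[u]` expressed through `τ((u⁻¹ du)³)`; passing from `u du⁻¹` to `u⁻¹ du` changes the sign. -/
theorem Gamma_eq_invariant
    (hdim : T.HasDimension 3) (hreg : T.Regular) (hclosed : T.Closed ω)
    {N : ℕ} (u : UN A N) :
    T.Gamma ω u = 1 / 3 * (integralConst *
      ((T.cycle hdim hreg ω hclosed).matrix (Fin N)).invariant u) := by
  set C := (T.cycle hdim hreg ω hclosed).matrix (Fin N) with hC
  have h1 := Unitary.mul_star_self_of_mem u.2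
  have h2 := Unitary.star_mul_self_of_mem u.2
  rw [Gamma_eq_trace_cube hdim hreg hclosed, ← hC, C.trace_cube_eq_neg_trace_cube h1,
    C.invariant_eq_of_inverse (I := C.π (star (u : Matrix (Fin N) (Fin N) A)))
      (by rw [← map_mul, h1, map_one]) (by rw [← map_mul, h2, map_one])]
  ring

theorem Gamma_eq_of_k1ClassClosure_eq
    (hdim : T.HasDimension 3) (hreg : T.Regular) (hclosed : T.Closed ω)
    {M N : ℕ} {u : UN A M} {v : UN A N}
    (h : T.k1ClassClosure u = T.k1ClassClosure v) :
    T.Gamma ω u = T.Gamma ω v := by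
  set C := T.cycle hdim hreg ω hclosed with hC
  set ι := (StarSubalgebra.inclusion T.π.range.le_topologicalClosure).comp T.π.rangeRestrict
    with hι
  have hS : (T.π.range.topologicalClosure : Set (H →L[ℂ] H)) ⊆ closure (Set.range C.π) :=
    fun x hx => hx
  have hval : ∀ {n : ℕ} (w : UN A n),
      C.HasValue ((UN.map ι w).1.map
        T.π.range.topologicalClosure.subtype) ((C.matrix (Fin n)).invariant w) := by
    intro n w
    obtain ⟨z, hz⟩ := ThreeCycle.exists_hasValue_unitary hS (UN.map ι w)
    have hz' : C.HasValue ((C.matrix (Fin n)).π w) z := hz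
    rwa [hz'.invariant_eq]
  rw [Gamma_eq_invariant hdim hreg hclosed, Gamma_eq_invariant hdim hreg hclosed,
    ThreeCycle.HasValue.eq_of_k1_eq hS h (hval u) (hval v)]

theorem Gamma_eq_of_k1Class_eq
    (hdim : T.HasDimension 3) (hreg : T.Regular) (hclosed : T.Closed ω)
    {M N : ℕ} {u : UN A M} {v : UN A N}
    (h : T.k1Class u = T.k1Class v) : T.Gamma ω u = T.Gamma ω v :=
  Gamma_eq_of_k1ClassClosure_eq hdim hreg hclosed
    (K1.mk_map_eq (f := StarSubalgebra.inclusion T.π.range.le_topologicalClosure)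
      (continuous_inclusion T.π.range.le_topologicalClosure) h)

end SpectralTriple

end SpectralTriple

theorem proposition3p1
    {A : Type*} [Ring A] [StarRing A] [Algebra ℂ A] [StarModule ℂ A]
    {H : Type*} [NormedAddCommGroup H] [InnerProductSpace ℂ H] [CompleteSpace H]
    [TopologicalSpace.SeparableSpace H]
    (T : SpectralTriple A H) (hdim : T.HasDimension 3) (hreg : T.Regular)
    (ω : DixmierLimit) (hclosed : T.Closed ω) :
    -- the cochain on matrices is a cyclic 3-cocycle
    (∀ N : ℕ, IsCyclicThreeCocycle
      (fun a₀ a₁ a₂ a₃ : Matrix (Fin N) (Fin N) A => T.PhiTilde ω a₀ a₁ a₂ a₃)) ∧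
    (∀ (N : ℕ) (u : UN A N),
      T.Gamma ω u = (1 / 3 : ℂ) *
        T.PhiTilde ω ((u : Matrix (Fin N) (Fin N) A) - 1) (star (u : Matrix (Fin N) (Fin N) A) - 1)
          ((u : Matrix (Fin N) (Fin N) A) - 1) (star (u : Matrix (Fin N) (Fin N) A) - 1)) ∧
    -- dependence on the connected component in the inductive limit over the algebra itself
    (∀ (M N : ℕ) (u : UN A M) (v : UN A N),
      T.k1Class u = T.k1Class v → T.Gamma ω u = T.Gamma ω v) ∧
    -- dependence on the class in the group of the norm closure
    (∀ (M N : ℕ) (u : UN A M) (v : UN A N),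
      T.k1ClassClosure u = T.k1ClassClosure v → T.Gamma ω u = T.Gamma ω v) := by
  exact ⟨SpectralTriple.isCyclicThreeCocycle_PhiTilde hdim hreg hclosed,
    fun _ => SpectralTriple.Gamma_eq_PhiTilde hdim hreg hclosed,
    fun _ _ _ _ => SpectralTriple.Gamma_eq_of_k1Class_eq hdim hreg hclosed,
    fun _ _ _ _ => SpectralTriple.Gamma_eq_of_k1ClassClosure_eq hdim hreg hclosed⟩
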